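/- **Theorem 3.2.** Let $\Omega\subset\mathbb{R}^n$ ($n\ge 1$) be a bounded domain (nonempty, open and connected). Let $\alpha:\Omega\to(0,1]$ satisfy $0<\alpha^-\le\alpha^+<1$, where $\alpha^-=\inf_\Omega\alpha$ and $\alpha^+=\sup_\Omega\alpha$, and let $\alpha$ be log-Hölder continuous: there is $M>0$ with $\bigl|\ln|x-y|\bigr|\,|\alpha(x)-\alpha(y)|\le M$ for all distinct $x,y\in\Omega$. Let $c_{\log}(\alpha)\ge 0$ be the smallest constant for which this inequality holds. For a bounded open set $A\subset\Omega$ with diameter $d=\operatorname{diam}A$ and $k\in\{0,1,2,\dots\}$, put $$|D^ku|_{0,A}=\sup_{x\in A,\ |\beta|=k}|D^\beta u(x)|,\qquad |u|_{0,A}=|D^0u|_{0,A},$$ $$|u|'_{k,\alpha(\cdot),A}=\sum_{j=0}^k d^j|D^ju|_{0,A}+\sup_{\substack{x,y\in A,\ x\ne y\\ |\beta|=k}}d^{\,k+\alpha(x)}\,\frac{|D^\beta u(x)-D^\beta u(y)|}{|x-y|^{\alpha(x)}},$$ with values in $[0,\infty]$. Let $f\in C^{\alpha(\cdot)}(\Omega)$,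 that is, $f:\Omega\to\mathbb{R}$ is continuous and for every compact $D\subset\Omega$ $$\sup_{D}|f|+\sup_{x,y\in D,\ x\neq y}\frac{|f(x)-f(y)|}{|x-y|^{\alpha(x)}}<\infty.$$ If $u:\Omega\to\mathbb{R}$ is twice continuously differentiable and satisfies $\Delta u=f$ in $\Omega$, then for all $x_0\in\mathbb{R}^n$ and $R>0$ such that, with $B_1=B(x_0,R)$ and $B_2=B(x_0,2R)$, the closure $\overline{B_2}$ is contained in $\Omega$, one has $$|u|'_{2,\alpha(\cdot),B_1}\le C\left(|u|_{0,B_2}+R^2|f|'_{0,\alpha(\cdot),B_2}\right),$$ where the finite constant $C$ depends only on $\operatorname{diam}\Omega$, $n$, $\alpha^-$, $\alpha^+$ and $c_{\log}(\alpha)$. -/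

import Mathlib

open scoped NNReal ENNReal

noncomputable section

namespace VariableHolder

/-- The space `ℝⁿ` with its Euclidean norm. -/
abbrev E (n : ℕ) : Type := EuclideanSpace ℝ (Fin n)

/-- The supremum of the exponent over `A`. -/
def expSup {n : ℕ} (α : E n → ℝ) (A : Set (E n)) : ℝ := sSup (α '' A)

/-- The infimum of the exponent over `A`. -/
def expInf {n : ℕ} (α : E n → ℝ) (A : Set (E n)) : ℝ := sInf (α '' A)

/-- `M` is a log-Hölder constant of `α` on `Ω`. The pairs `x = y` impose no condition, since then
`α x - α y = 0`. -/
def IsLogHolderConst {n : ℕ} (α : E n → ℝ) (Ω : Set (E n)) (M : ℝ) : Prop :=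
  ∀ x ∈ Ω, ∀ y ∈ Ω, |Real.log ‖x - y‖| * |α x - α y| ≤ M

/-- `α` is log-Hölder continuous on `Ω`. -/
def IsLogHolder {n : ℕ} (α : E n → ℝ) (Ω : Set (E n)) : Prop :=
  ∃ M : ℝ, 0 < M ∧ IsLogHolderConst α Ω M

/-- The smallest log-Hölder constant `c_log(α)`, where the value `0` (for instance for a
constant exponent) is allowed. -/
def cLog {n : ℕ} (α : E n → ℝ) (Ω : Set (E n)) : ℝ :=
  sInf {M : ℝ | 0 ≤ M ∧ IsLogHolderConst α Ω M}

/-- The class `𝒜^log(Ω)` of exponents `α : Ω → (0, 1]` with `0 < α⁻ ≤ α⁺ < 1` that are log-Hölder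
continuous in `Ω`. Only the values of `α` on `Ω` matter. -/
structure IsLogExponent {n : ℕ} (α : E n → ℝ) (Ω : Set (E n)) : Prop where
  mem_Ioc : ∀ x ∈ Ω, α x ∈ Set.Ioc (0 : ℝ) 1
  expInf_pos : 0 < expInf α Ω
  expInf_le_expSup : expInf α Ω ≤ expSup α Ω
  expSup_lt_one : expSup α Ω < 1
  logHolder : IsLogHolder α Ω

/-- The iterated partial derivative `∂_{β 0} ⋯ ∂_{β (k-1)} u (x)` of order `k`. For a `C^k`
function, these are exactly the derivatives `D^β u` over multi-indices of order `k`. -/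
def pderiv {n k : ℕ} (β : Fin k → Fin n) (u : E n → ℝ) (x : E n) : ℝ :=
  iteratedFDeriv ℝ k u x (fun i => EuclideanSpace.single (β i) (1 : ℝ))

/-- `|D^k u|_{0,A} = [u]_{k,0,A}`, the supremum of `|D^β u(x)|` over `x ∈ A` and `|β| = k`, as an
extended nonnegative real. -/
def supDeriv {n : ℕ} (k : ℕ) (u : E n → ℝ) (A : Set (E n)) : ℝ≥0∞ :=
  ⨆ x ∈ A, ⨆ β : Fin k → Fin n, ENNReal.ofReal |pderiv β u x|

/-- `[u]_{k,α(·),A}`, the supremum of `|D^β u(x) - D^β u(y)| / |x - y|^{α(x)}` over distinct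
`x, y ∈ A` and `|β| = k`. -/
def holderSeminorm {n : ℕ} (k : ℕ) (α : E n → ℝ) (u : E n → ℝ) (A : Set (E n)) : ℝ≥0∞ :=
  ⨆ x ∈ A, ⨆ y ∈ A, ⨆ _ : x ≠ y, ⨆ β : Fin k → Fin n,
    ENNReal.ofReal (|pderiv β u x - pderiv β u y| / ‖x - y‖ ^ α x)

/-- The supremum of `d^{k+α(x)} |D^β u(x) - D^β u(y)| / |x - y|^{α(x)}` over distinct
`x, y ∈ A` and `|β| = k`, where `d = diam A`. -/
def scaledHolderSeminorm {n : ℕ} (k : ℕ) (α : E n → ℝ) (u : E n → ℝ) (A : Set (E n)) : ℝ≥0∞ :=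
  ⨆ x ∈ A, ⨆ y ∈ A, ⨆ _ : x ≠ y, ⨆ β : Fin k → Fin n,
    ENNReal.ofReal (Metric.diam A ^ ((k : ℝ) + α x) *
      (|pderiv β u x - pderiv β u y| / ‖x - y‖ ^ α x))

/-- `|u|'_{k,A} = ∑_{j ≤ k} d^j |D^j u|_{0,A}`, where `d = diam A`. -/
def scaledCkNorm {n : ℕ} (k : ℕ) (u : E n → ℝ) (A : Set (E n)) : ℝ≥0∞ :=
  ∑ j ∈ Finset.range (k + 1), ENNReal.ofReal (Metric.diam A ^ j) * supDeriv j u A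

/-- The norm `|u|'_{k,α(·),A}`, for a bounded open set `A`; it is `∞` if one of its terms is. -/
def scaledHolderNorm {n : ℕ} (k : ℕ) (α : E n → ℝ) (u : E n → ℝ) (A : Set (E n)) : ℝ≥0∞ :=
  scaledCkNorm k u A + scaledHolderSeminorm k α u A

/-- `f ∈ C^{α(·)}(Ω)`: `f` is continuous on `Ω`, and for each compact `D ⊆ Ω` the quantity
`|f|_{0,D} + [f]_{α(·),D}` is finite. -/
def MemHolder {n : ℕ} (α : E n → ℝ) (f : E n → ℝ) (Ω : Set (E n)) : Prop :=
  ContinuousOn f Ω ∧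
    ∀ D : Set (E n), IsCompact D → D ⊆ Ω → supDeriv 0 f D + holderSeminorm 0 α f D < ∞

/-- `A ⊂⊂ Ω`: the closure of `A` is compact and contained in `Ω`. -/
def CompactlyContained {n : ℕ} (A Ω : Set (E n)) : Prop :=
  IsCompact (closure A) ∧ closure A ⊆ Ω

end VariableHolder

end

/-!
The proof replaces potential theory by an exact formula for how averages of `u` change with the
scale. Take a radial bump `G` supported in the unit ball, write `∇G = -z ρ(z)`, and normalise so that
`∫ ρ = 1`. Then `n ρ + z · ∇ρ = div (z ρ) = -ΔG`, and differentiating this identity gives, for every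
partial derivative `∂^β` of order `m`, the relation `(n + m) ∂^β ρ + z · ∇∂^β ρ = -Δ ∂^β G`
(`ScalingPair`). Integration by parts turns it into
`d/dτ [τ^{-m} ∫ u(x + τz) ∂^β ρ(z) dz] = τ^{1-m} ∫ Δu(x + τz) ∂^β G(z) dz`
(`ScalingPair.hasDerivAt_avg`), while the bracket tends to `±∂^β u(x)` as `τ → 0` for `m ≤ 2`.

With `f = Δu` and `|β| = 2` the kernel `∂^β G` has mean zero, so Hölder continuity of `f` at `x` bounds
the right-hand side by a multiple of `τ^{α(x) - 1}`, which is integrable at `0`. Hence `∂^β u(x)`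
differs from its average at scale `r` by `O(r^{α(x)})`
(`EstimateData.abs_avg_sub_dirDeriv_le`); at `r = R` this bounds `∂^β u(x)` itself, and the same
argument with `m = 1` bounds the gradient. For two points `x`, `y` at distance `t`, the averages are
compared at the scale `t / 2`: between `t / 2` and `R` the difference of the two scale derivatives is
`O(t τ^{α(x) - 2})`, because the kernel is Lipschitz, and integrates to `O(t^{α(x)} / (1 - α⁺))`
(`EstimateData.abs_avg_sub_avg_le`).

The exponent at `y` enters only through the error `t^{α(y)}` of the average at `y`; log-Hölder
continuity converts it into a multiple of `t^{α(x)}` (`IsLogExponent.rpow_le`). Multiplying `u` by a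
cutoff that equals `1` on `B(x₀, 2R)` makes it compactly supported on the whole space without changing
either side of the estimate.
-/

noncomputable section

namespace VariableHolder

open MeasureTheory Metric Set Filter Topology
open scoped ContDiff

variable {n : ℕ}

/-! ### Averages against a compactly supported kernel -/

/-- The partial derivative `∂ᵢ k`. -/
def dirDeriv (i : Fin n) (k : E n → ℝ) (z : E n) : ℝ :=
  fderiv ℝ k z (EuclideanSpace.single i 1)

/-- The Laplacian as the sum of the pure second partial derivatives. -/
def lap (k : E n → ℝ) (z : E n) : ℝ := ∑ i, dirDeriv i (dirDeriv i k) z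

/-- A smooth kernel supported in the closed unit ball. -/
structure IsKernel (k : E n → ℝ) : Prop where
  contDiff : ContDiff ℝ ∞ k
  tsupport_subset : tsupport k ⊆ closedBall 0 1

/-- The average of `u` at the point `x` and the scale `τ`, weighted by the kernel `k`. The kernel
is not normalised. -/
def avg (u k : E n → ℝ) (x : E n) (τ : ℝ) : ℝ := ∫ z, u (x + τ • z) * k z

lemma contDiff_dirDeriv {m : WithTop ℕ∞} {k : E n → ℝ} (hk : ContDiff ℝ (m + 1) k) (i : Fin n) :
    ContDiff ℝ m (dirDeriv i k) :=
  (hk.fderiv_right le_rfl).clm_apply contDiff_const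

lemma hasCompactSupport_dirDeriv {k : E n → ℝ} (hk : HasCompactSupport k) (i : Fin n) :
    HasCompactSupport (dirDeriv i k) :=
  hk.fderiv_apply ℝ _

namespace IsKernel

variable {k : E n → ℝ}

lemma continuous (hk : IsKernel k) : Continuous k := hk.contDiff.continuous

lemma hasCompactSupport (hk : IsKernel k) : HasCompactSupport k :=
  (isCompact_closedBall 0 1).of_isClosed_subset (isClosed_tsupport k) hk.tsupport_subset

lemma norm_le_one (hk : IsKernel k) {z : E n} (hz : k z ≠ 0) : ‖z‖ ≤ 1 := by
  simpa using hk.tsupport_subset (subset_tsupport k hz)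

lemma dirDeriv (hk : IsKernel k) (i : Fin n) : IsKernel (dirDeriv i k) where
  contDiff := contDiff_dirDeriv (by simpa using hk.contDiff) i
  tsupport_subset := (tsupport_fderiv_apply_subset ℝ _).trans hk.tsupport_subset

lemma coord_mul (hk : IsKernel k) (i : Fin n) : IsKernel (fun z => z i * k z) where
  contDiff := by
    have h := hk.contDiff
    fun_prop
  tsupport_subset := (tsupport_mul_subset_right (f := fun z : E n => z i)).trans hk.tsupport_subset

lemma integrable_mul (hk : IsKernel k) {v : E n → ℝ} (hv : Continuous v) :
    Integrable (fun z => v z * k z) :=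
  (hv.mul hk.continuous).integrable_of_hasCompactSupport hk.hasCompactSupport.mul_left

lemma integrable (hk : IsKernel k) : Integrable k :=
  hk.continuous.integrable_of_hasCompactSupport hk.hasCompactSupport

end IsKernel

lemma dirDeriv_comp_affine {v : E n → ℝ} (hv : ContDiff ℝ 1 v) (x : E n) (τ : ℝ) (i : Fin n)
    (z : E n) : dirDeriv i (fun z => v (x + τ • z)) z = τ * dirDeriv i v (x + τ • z) := by
  have h1 : HasFDerivAt (fun z : E n => x + τ • z) (τ • ContinuousLinearMap.id ℝ (E n)) z :=
    ((hasFDerivAt_id z).const_smul τ).const_add x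
  have h2 := ((hv.differentiable (by norm_num)) (x + τ • z)).hasFDerivAt.comp z h1
  have h3 : fderiv ℝ (fun z => v (x + τ • z)) z = _ := h2.fderiv
  simp [dirDeriv, h3]

/-- Integration by parts: a derivative on the kernel moves to the averaged function. -/
lemma avg_dirDeriv {v k : E n → ℝ} (hv : ContDiff ℝ 1 v) (hk : IsKernel k) (i : Fin n)
    (x : E n) (τ : ℝ) : avg v (dirDeriv i k) x τ = -(τ * avg (dirDeriv i v) k x τ) := by
  have hc : ContDiff ℝ 1 (fun z : E n => v (x + τ • z)) := by fun_prop
  have h := integral_mul_fderiv_eq_neg_fderiv_mul_of_integrable (μ := volume)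
    (f := fun z : E n => v (x + τ • z)) (g := k) (v := EuclideanSpace.single i 1)
    (hk.integrable_mul (contDiff_dirDeriv (m := 0) (by simpa using hc) i).continuous)
    ((hk.dirDeriv i).integrable_mul hc.continuous) (hk.integrable_mul hc.continuous)
    (fun z _ => hc.differentiable (by norm_num) z)
    (fun z _ => hk.contDiff.differentiable (by simp) z)
  calc avg v (dirDeriv i k) x τ
      = -∫ z, dirDeriv i (fun z => v (x + τ • z)) z * k z := h
    _ = -(τ * avg (dirDeriv i v) k x τ) := by
      simp_rw [dirDeriv_comp_affine hv, avg, mul_assoc, integral_const_mul]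

lemma avg_lap {v k : E n → ℝ} (hv : ContDiff ℝ 2 v) (hk : IsKernel k) (x : E n) (τ : ℝ) :
    avg v (lap k) x τ = τ ^ 2 * avg (lap v) k x τ := by
  have h1 (i : Fin n) : avg v (dirDeriv i (dirDeriv i k)) x τ
      = τ ^ 2 * avg (dirDeriv i (dirDeriv i v)) k x τ := by
    rw [avg_dirDeriv (hv.of_le (by norm_num)) (hk.dirDeriv i), avg_dirDeriv _ hk]
    · ring
    · exact contDiff_dirDeriv (by simpa [one_add_one_eq_two] using hv) i
  have h2 : avg v (lap k) x τ = ∑ i, avg v (dirDeriv i (dirDeriv i k)) x τ := by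
    simp only [avg, lap, Finset.mul_sum]
    refine integral_finsetSum _ fun i _ => ?_
    exact ((hk.dirDeriv i).dirDeriv i).integrable_mul (hv.continuous.comp (by fun_prop))
  have h3 : avg (lap v) k x τ = ∑ i, avg (dirDeriv i (dirDeriv i v)) k x τ := by
    simp only [avg, lap, Finset.sum_mul]
    refine integral_finsetSum _ fun i _ => ?_
    refine hk.integrable_mul (Continuous.comp (g := dirDeriv i (dirDeriv i v)) ?_ (by fun_prop))
    have := contDiff_dirDeriv (m := 1) (by simpa [one_add_one_eq_two] using hv) i
    exact (contDiff_dirDeriv (m := 0) (by simpa using this) i).continuous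
  rw [h2, h3, Finset.mul_sum]
  exact Finset.sum_congr rfl fun i _ => h1 i

lemma continuous_avg {v k : E n → ℝ} (hv : Continuous v) (hc : HasCompactSupport v)
    (hk : IsKernel k) (x : E n) : Continuous (avg v k x) := by
  obtain ⟨C, hC⟩ := hc.exists_bound_of_continuous hv
  refine continuous_of_dominated (bound := fun z => C * ‖k z‖) ?_ ?_ ?_ ?_
  · intro τ
    exact (hk.integrable_mul (v := fun z => v (x + τ • z))
      (hv.comp (by fun_prop))).aestronglyMeasurable
  · intro τ
    refine ae_of_all _ fun z => ?_
    rw [norm_mul]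
    exact mul_le_mul_of_nonneg_right (hC _) (norm_nonneg _)
  · exact hk.integrable.norm.const_mul C
  · refine ae_of_all _ fun z => ?_
    exact (hv.comp (by fun_prop)).mul continuous_const

lemma hasDerivAt_avg {v k : E n → ℝ} (hv : ContDiff ℝ 1 v) (hc : HasCompactSupport v)
    (hk : IsKernel k) (x : E n) (τ : ℝ) :
    HasDerivAt (avg v k x) (∫ z, fderiv ℝ v (x + τ • z) z * k z) τ := by
  have hv' : Continuous (fderiv ℝ v) := hv.continuous_fderiv (by norm_num)
  obtain ⟨C, hC⟩ := (hc.fderiv ℝ).exists_bound_of_continuous hv'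
  have hcont (σ : ℝ) : Continuous fun z : E n => fderiv ℝ v (x + σ • z) z :=
    (hv'.comp (by fun_prop)).clm_apply continuous_id
  refine (hasDerivAt_integral_of_dominated_loc_of_deriv_le (s := univ) (F := fun σ z =>
    v (x + σ • z) * k z) (F' := fun σ z => fderiv ℝ v (x + σ • z) z * k z)
    (bound := fun z => ‖(C * ‖z‖) * k z‖) univ_mem ?_ ?_ ?_ ?_ ?_ ?_).2
  · refine Eventually.of_forall fun σ => ?_
    exact (hk.integrable_mul (v := fun z => v (x + σ • z))
      (hv.continuous.comp (by fun_prop))).aestronglyMeasurable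
  · exact hk.integrable_mul (v := fun z => v (x + τ • z)) (hv.continuous.comp (by fun_prop))
  · exact (hk.integrable_mul (hcont τ)).aestronglyMeasurable
  · refine ae_of_all _ fun z σ _ => ?_
    rw [norm_mul, norm_mul]
    refine mul_le_mul_of_nonneg_right ?_ (norm_nonneg _)
    refine ((fderiv ℝ v (x + σ • z)).le_opNorm z).trans ?_
    exact (mul_le_mul_of_nonneg_right (hC _) (norm_nonneg _)).trans (le_abs_self _)
  · exact (hk.integrable_mul (v := fun z => C * ‖z‖) (by fun_prop)).norm
  · refine ae_of_all _ fun z σ _ => ?_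
    have h1 : HasDerivAt (fun σ : ℝ => x + σ • z) z σ := by
      simpa using ((hasDerivAt_id σ).smul_const z).const_add x
    exact (((hv.differentiable (by norm_num)) (x + σ • z)).hasFDerivAt.comp_hasDerivAt σ
      h1).mul_const (k z)

lemma fderiv_apply_eq_sum (v : E n → ℝ) (y z : E n) :
    fderiv ℝ v y z = ∑ i, z i * dirDeriv i v y := by
  conv_lhs => rw [← (EuclideanSpace.basisFun (Fin n) ℝ).sum_repr z]
  simp [dirDeriv]

/-- The coordinate form of `div (z k) = n k + z · ∇k`. -/
lemma sum_dirDeriv_coord_mul {k : E n → ℝ} (hk : Differentiable ℝ k) (z : E n) :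
    ∑ i, dirDeriv i (fun z => z i * k z) z = n * k z + fderiv ℝ k z z := by
  have h (i : Fin n) : dirDeriv i (fun z => z i * k z) z = k z + z i * dirDeriv i k z := by
    have h1 : HasFDerivAt (fun z : E n => z i) (EuclideanSpace.proj i : E n →L[ℝ] ℝ) z :=
      (EuclideanSpace.proj i : E n →L[ℝ] ℝ).hasFDerivAt
    have h2 := h1.mul (hk z).hasFDerivAt
    have h3 : fderiv ℝ (fun z : E n => z i * k z) z = _ := h2.fderiv
    simp [dirDeriv, h3]
    ring
  simp [h, Finset.sum_add_distrib, fderiv_apply_eq_sum k z z]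

lemma mul_integral_fderiv_mul {v k : E n → ℝ} (hv : ContDiff ℝ 1 v) (hk : IsKernel k)
    (x : E n) (τ : ℝ) :
    τ * ∫ z, fderiv ℝ v (x + τ • z) z * k z
      = -avg v (fun z => n * k z + fderiv ℝ k z z) x τ := by
  have h1 : ∫ z, fderiv ℝ v (x + τ • z) z * k z
      = ∑ i, avg (dirDeriv i v) (fun z => z i * k z) x τ := by
    simp only [avg]
    rw [← integral_finsetSum]
    · refine integral_congr_ae (ae_of_all _ fun z => ?_)
      simp only [fderiv_apply_eq_sum v (x + τ • z) z, Finset.sum_mul]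
      exact Finset.sum_congr rfl fun i _ => by ring
    · intro i _
      refine (hk.coord_mul i).integrable_mul (Continuous.comp (g := dirDeriv i v) ?_ (by fun_prop))
      exact (contDiff_dirDeriv (m := 0) (by simpa using hv) i).continuous
  have h2 : avg v (fun z => n * k z + fderiv ℝ k z z) x τ
      = ∑ i, avg v (dirDeriv i fun z => z i * k z) x τ := by
    simp only [avg]
    rw [← integral_finsetSum]
    · refine integral_congr_ae (ae_of_all _ fun z => ?_)
      simp only [← sum_dirDeriv_coord_mul (hk.contDiff.differentiable (by simp)), Finset.mul_sum]
    · intro i _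
      exact ((hk.coord_mul i).dirDeriv i).integrable_mul (hv.continuous.comp (by fun_prop))
  rw [h1, h2, Finset.mul_sum, ← Finset.sum_neg_distrib]
  refine Finset.sum_congr rfl fun i _ => ?_
  rw [avg_dirDeriv hv (hk.coord_mul i), neg_neg]

/-! ### Scaling pairs of kernels -/

/-- A pair of kernels `(k, H)` with `(n + m) k + z · ∇k = -ΔH`. This says that the rescaled kernels
`k_τ(z) = τ^{-n-m} k(z/τ)` satisfy `∂k_τ/∂τ = τ^{-n-m-1} (ΔH)(z/τ)`, so that averages of `u` against
`k_τ` vary in the scale `τ` by averages of `Δu` against `H`. -/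
structure ScalingPair (m : ℕ) (k H : E n → ℝ) : Prop where
  left : IsKernel k
  right : IsKernel H
  eq_neg_lap : ∀ z, (n + m) * k z + fderiv ℝ k z z = -lap H z

lemma fderiv_dirDeriv_apply {u : E n → ℝ} (hu : ContDiff ℝ 2 u) (j : Fin n) (x v : E n) :
    fderiv ℝ (dirDeriv j u) x v = fderiv ℝ (fderiv ℝ u) x v (EuclideanSpace.single j 1) := by
  have hd : DifferentiableAt ℝ (fderiv ℝ u) x :=
    (hu.fderiv_right (m := 1) (by norm_num)).differentiable (by norm_num) x
  have h := hd.hasFDerivAt.clm_apply (hasFDerivAt_const (EuclideanSpace.single j (1 : ℝ)) x)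
  have h3 : fderiv ℝ (dirDeriv j u) x = _ := h.fderiv
  rw [h3]
  simp

lemma fderiv_fderiv_single {u : E n → ℝ} (hu : ContDiff ℝ 2 u) (i j : Fin n) (x : E n) :
    fderiv ℝ (fderiv ℝ u) x (EuclideanSpace.single i 1) (EuclideanSpace.single j 1)
      = dirDeriv i (dirDeriv j u) x :=
  (fderiv_dirDeriv_apply hu j x _).symm

lemma dirDeriv_comm {k : E n → ℝ} (hk : ContDiff ℝ 2 k) (i j : Fin n) (z : E n) :
    dirDeriv i (dirDeriv j k) z = dirDeriv j (dirDeriv i k) z := by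
  rw [← fderiv_fderiv_single hk, ← fderiv_fderiv_single hk]
  exact (hk.contDiffAt.isSymmSndFDerivAt (by simp)).eq _ _

lemma dirDeriv_lap {k : E n → ℝ} (hk : ContDiff ℝ ∞ k) (i : Fin n) (z : E n) :
    dirDeriv i (lap k) z = lap (dirDeriv i k) z := by
  have hs {f : E n → ℝ} (hf : ContDiff ℝ ∞ f) (j : Fin n) : ContDiff ℝ ∞ (dirDeriv j f) :=
    contDiff_dirDeriv (by simpa using hf) j
  have h1 : dirDeriv i (lap k) z = ∑ j, dirDeriv i (dirDeriv j (dirDeriv j k)) z := by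
    have h := HasFDerivAt.fun_sum (u := Finset.univ) (fun (j : Fin n) _ =>
      ((hs (hs hk j) j).differentiable (by simp) z).hasFDerivAt)
    have h3 : fderiv ℝ (lap k) z = _ := h.fderiv
    rw [dirDeriv, h3]
    simp [dirDeriv]
  rw [h1, lap]
  refine Finset.sum_congr rfl fun j _ => ?_
  rw [dirDeriv_comm ((hs hk j).of_le ENat.LEInfty.out)]
  congr 1
  ext w
  exact dirDeriv_comm (hk.of_le ENat.LEInfty.out) i j w

/-- Differentiating a scaling pair gives a scaling pair of the next order. -/
lemma ScalingPair.dirDeriv {m : ℕ} {k H : E n → ℝ} (h : ScalingPair m k H) (i : Fin n) :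
    ScalingPair (m + 1) (dirDeriv i k) (dirDeriv i H) where
  left := h.left.dirDeriv i
  right := h.right.dirDeriv i
  eq_neg_lap z := by
    rw [← dirDeriv_lap h.right.contDiff]
    have hk := h.left.contDiff
    have hd : DifferentiableAt ℝ (fderiv ℝ k) z :=
      (hk.fderiv_right (m := ∞) le_rfl).differentiable (by simp) z
    have h1 : HasFDerivAt (fun z => ((n : ℝ) + m) * k z + fderiv ℝ k z z) _ z :=
      ((hk.differentiable (by simp) z).hasFDerivAt.const_mul ((n : ℝ) + m)).add
        (hd.hasFDerivAt.clm_apply (hasFDerivAt_id z))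
    have h2 : (fun z => ((n : ℝ) + m) * k z + fderiv ℝ k z z) = fun z => -lap H z :=
      funext h.eq_neg_lap
    have h3 : VariableHolder.dirDeriv i (fun z => -lap H z) z
        = -VariableHolder.dirDeriv i (lap H) z := by
      simp [VariableHolder.dirDeriv]
    have h4 : fderiv ℝ (VariableHolder.dirDeriv i k) z z
        = fderiv ℝ (fderiv ℝ k) z (EuclideanSpace.single i 1) z := by
      have hk2 : ContDiff ℝ 2 k := hk.of_le ENat.LEInfty.out
      rw [fderiv_dirDeriv_apply hk2]
      exact (hk2.contDiffAt.isSymmSndFDerivAt (by simp)).eq _ _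
    rw [← h3, ← h2, VariableHolder.dirDeriv.eq_def i (fun z => _ + _), h1.fderiv, h4]
    simp [VariableHolder.dirDeriv]
    ring

/-- The basic formula: the scale derivative of an average of `u` is an average of `Δu`. -/
lemma ScalingPair.hasDerivAt_avg {m : ℕ} {u k H : E n → ℝ} (h : ScalingPair m k H)
    (hu : ContDiff ℝ 2 u) (hc : HasCompactSupport u) (x : E n) {τ : ℝ} (hτ : 0 < τ) :
    HasDerivAt (fun τ => (τ ^ m)⁻¹ * avg u k x τ) (τ * (τ ^ m)⁻¹ * avg (lap u) H x τ) τ := by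
  have hu1 : ContDiff ℝ 1 u := hu.of_le (by norm_num)
  have h1 := ((hasDerivAt_pow m τ).inv (by positivity)).mul
    (VariableHolder.hasDerivAt_avg hu1 hc h.left x τ)
  refine h1.congr_deriv ?_
  have h2 := mul_integral_fderiv_mul hu1 h.left x τ
  have h3 : avg u (fun z => n * k z + fderiv ℝ k z z) x τ
      = -(τ ^ 2 * avg (lap u) H x τ) - m * avg u k x τ := by
    have h4 : (fun z => n * k z + fderiv ℝ k z z) = fun z => -lap H z - m * k z := by
      ext z
      linarith [h.eq_neg_lap z]
    have hi : Integrable fun z => u (x + τ • z) * k z :=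
      h.left.integrable_mul (v := fun z => u (x + τ • z)) (hu.continuous.comp (by fun_prop))
    have hi' : Integrable fun z => u (x + τ • z) * lap H z := by
      simp only [lap, Finset.mul_sum]
      refine integrable_finsetSum _ fun i _ => ?_
      exact ((h.right.dirDeriv i).dirDeriv i).integrable_mul (hu.continuous.comp (by fun_prop))
    rw [h4, ← avg_lap hu h.right]
    simp only [avg]
    rw [← integral_const_mul, ← integral_neg, ← integral_sub hi'.fun_neg (hi.const_mul _)]
    exact integral_congr_ae (ae_of_all _ fun z => by ring)
  rw [h3] at h2
  have h5 : ∫ z, fderiv ℝ u (x + τ • z) z * k z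
      = τ * avg (lap u) H x τ + m * τ⁻¹ * avg u k x τ := by
    field_simp
    linarith
  rw [h5]
  rcases m with _ | m
  · simp
  · simp only [Pi.inv_apply]
    field_simp
    simp only [Nat.add_sub_cancel]
    push_cast
    ring

/-! ### A radial mollifier and its scaling partner -/

lemma contDiff_deriv_expNegInvGlue : ContDiff ℝ ∞ (deriv expNegInvGlue) :=
  ((contDiff_infty_iff_deriv (f := expNegInvGlue)).1 expNegInvGlue.contDiff).2

lemma deriv_expNegInvGlue_of_neg {s : ℝ} (hs : s < 0) : deriv expNegInvGlue s = 0 := by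
  have h : expNegInvGlue =ᶠ[𝓝 s] fun _ => 0 := by
    filter_upwards [Iio_mem_nhds hs] with t ht
    exact expNegInvGlue.zero_of_nonpos (le_of_lt ht)
  simp [h.deriv_eq]

/-- The multiple `c φ(1 - |z|²)` of a radial bump, where `φ` is `expNegInvGlue`. -/
def radialBump (n : ℕ) (c : ℝ) (z : E n) : ℝ := c * expNegInvGlue (1 - ‖z‖ ^ 2)

/-- The function `2 c φ'(1 - |z|²)`; the gradient of `radialBump n c` is `-z` times it. -/
def radialSlope (n : ℕ) (c : ℝ) (z : E n) : ℝ := 2 * c * deriv expNegInvGlue (1 - ‖z‖ ^ 2)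

lemma isKernel_of_radial {g : ℝ → ℝ} (hg : ContDiff ℝ ∞ g) (h0 : ∀ s < 0, g s = 0) (c : ℝ) :
    IsKernel (fun z : E n => c * g (1 - ‖z‖ ^ 2)) where
  contDiff := contDiff_const.mul (hg.comp (contDiff_const.sub (contDiff_norm_sq ℝ)))
  tsupport_subset := by
    refine closure_minimal (fun z hz => ?_) isClosed_closedBall
    rw [mem_closedBall_zero_iff]
    by_contra! h
    refine hz ?_
    have : (1 : ℝ) - ‖z‖ ^ 2 < 0 := by nlinarith
    simp [h0 _ this]

lemma isKernel_radialBump (n : ℕ) (c : ℝ) : IsKernel (radialBump n c) :=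
  isKernel_of_radial expNegInvGlue.contDiff (fun _ h => expNegInvGlue.zero_of_nonpos h.le) c

lemma isKernel_radialSlope (n : ℕ) (c : ℝ) : IsKernel (radialSlope n c) :=
  isKernel_of_radial contDiff_deriv_expNegInvGlue (fun _ h => deriv_expNegInvGlue_of_neg h) (2 * c)

lemma fderiv_radialBump (c : ℝ) (z v : E n) :
    fderiv ℝ (radialBump n c) z v = -(radialSlope n c z * inner ℝ z v) := by
  have h1 : HasFDerivAt (fun z : E n => 1 - ‖z‖ ^ 2) _ z :=
    ((hasStrictFDerivAt_norm_sq z).hasFDerivAt).const_sub 1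
  have h2 : HasDerivAt expNegInvGlue (deriv expNegInvGlue (1 - ‖z‖ ^ 2)) (1 - ‖z‖ ^ 2) :=
    ((expNegInvGlue.contDiff (n := 1)).differentiable (by norm_num) _).hasDerivAt
  have h3 := (HasDerivAt.comp_hasFDerivAt (h₂ := expNegInvGlue) z h2 h1).const_mul c
  have h4 : fderiv ℝ (radialBump n c) z = _ := h3.fderiv
  rw [h4]
  simp [radialSlope]
  ring

lemma scalingPair_radial (n : ℕ) (c : ℝ) : ScalingPair 0 (radialSlope n c) (radialBump n c) where
  left := isKernel_radialSlope n c
  right := isKernel_radialBump n c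
  eq_neg_lap z := by
    have h (i : Fin n) : dirDeriv i (radialBump n c) = -fun z => z i * radialSlope n c z := by
      ext z
      simp [dirDeriv, fderiv_radialBump, EuclideanSpace.inner_single_right, mul_comm]
    have h2 (i : Fin n) : dirDeriv i (-fun z : E n => z i * radialSlope n c z) z
        = -dirDeriv i (fun z => z i * radialSlope n c z) z := by
      simp [dirDeriv, fderiv_neg]
    have h3 := sum_dirDeriv_coord_mul
      ((isKernel_radialSlope n c).contDiff.differentiable (by simp)) z
    simp only [lap, h, h2, Finset.sum_neg_distrib, h3]
    simp

lemma integral_radialSlope_pos (hn : 1 ≤ n) : 0 < ∫ z, radialSlope n 1 z := by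
  have hk := isKernel_radialSlope n 1
  by_cases hex : ∃ z, radialSlope n 1 z ≠ 0
  · obtain ⟨z, hz⟩ := hex
    refine hk.continuous.integral_pos_of_hasCompactSupport_nonneg_nonzero hk.hasCompactSupport
      (fun z => ?_) hz
    exact mul_nonneg (by norm_num) (expNegInvGlue.monotone.deriv_nonneg)
  -- If the slope vanishes identically then the bump is constant, but it is `0` on the unit sphere
  -- and positive at the origin.
  · push Not at hex
    have hd : ∀ z, fderiv ℝ (radialBump n 1) z = 0 := fun z => by
      ext v
      simp [fderiv_radialBump, hex]
    have h := is_const_of_fderiv_eq_zero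
      ((isKernel_radialBump n 1).contDiff.differentiable (by simp)) hd 0
      (EuclideanSpace.single ⟨0, hn⟩ 1)
    have hpos := expNegInvGlue.pos_of_pos (x := 1) one_pos
    have h' : expNegInvGlue 1 = 0 := by simpa [radialBump] using h
    exact absurd h' hpos.ne'

lemma exists_scalingPair (hn : 1 ≤ n) :
    ∃ ρ G : E n → ℝ, ScalingPair 0 ρ G ∧ ∫ z, ρ z = 1 := by
  refine ⟨_, _, scalingPair_radial n (∫ z, radialSlope n 1 z)⁻¹, ?_⟩
  have h (c : ℝ) : ∫ z, radialSlope n c z = c * ∫ z, radialSlope n 1 z := by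
    rw [← integral_const_mul]
    refine integral_congr_ae (ae_of_all _ fun z => ?_)
    simp only [radialSlope]
    ring
  rw [h, inv_mul_cancel₀ (integral_radialSlope_pos hn).ne']

/-! ### Bounds for averages -/

/-- `A` bounds the `L¹` norm and the Lipschitz constant of `k`. -/
structure KernelBound (A : ℝ) (k : E n → ℝ) : Prop where
  integral_le : ∫ z, |k z| ≤ A
  lipschitz : ∀ z w, |k z - k w| ≤ A * ‖z - w‖

lemma KernelBound.nonneg {A : ℝ} {k : E n → ℝ} (h : KernelBound A k) : 0 ≤ A :=
  (integral_nonneg fun _ => abs_nonneg _).trans h.integral_le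

lemma KernelBound.mono {A A' : ℝ} {k : E n → ℝ} (h : KernelBound A k) (hA : A ≤ A') :
    KernelBound A' k where
  integral_le := h.integral_le.trans hA
  lipschitz z w := (h.lipschitz z w).trans (by gcongr)

lemma IsKernel.exists_kernelBound {k : E n → ℝ} (hk : IsKernel k) : ∃ A, KernelBound A k := by
  obtain ⟨L, hL⟩ := (hk.contDiff.of_le (m := 1) ENat.LEInfty.out).lipschitzWith_of_hasCompactSupport
    hk.hasCompactSupport (by norm_num)
  refine ⟨max (∫ z, |k z|) L, le_max_left _ _, fun z w => ?_⟩
  have := hL.dist_le_mul z w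
  rw [Real.dist_eq, dist_eq_norm] at this
  exact this.trans (by gcongr; exact le_max_right _ _)

lemma exists_kernelBound_forall {ι : Type*} [Finite ι] (k : ι → E n → ℝ)
    (hk : ∀ i, IsKernel (k i)) : ∃ A, ∀ i, KernelBound A (k i) := by
  choose A hA using fun i => (hk i).exists_kernelBound
  obtain ⟨M, hM⟩ := (Set.finite_range A).bddAbove
  exact ⟨M, fun i => (hA i).mono (hM ⟨i, rfl⟩)⟩

lemma abs_avg_le {v k : E n → ℝ} (hk : IsKernel k) {A M : ℝ} (hA : KernelBound A k) (hM : 0 ≤ M)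
    {x : E n} {τ : ℝ} (hv : ∀ z, ‖z‖ ≤ 1 → |v (x + τ • z)| ≤ M) :
    |avg v k x τ| ≤ M * A := by
  have h : ‖avg v k x τ‖ ≤ ∫ z, M * |k z| := by
    refine norm_integral_le_of_norm_le (hk.integrable.abs.const_mul M) (ae_of_all _ fun z => ?_)
    rw [norm_mul, Real.norm_eq_abs, Real.norm_eq_abs]
    rcases eq_or_ne (k z) 0 with h0 | h0
    · simp [h0]
    · exact mul_le_mul_of_nonneg_right (hv z (hk.norm_le_one h0)) (abs_nonneg _)
  rw [integral_const_mul] at h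
  exact h.trans (by gcongr; exact hA.integral_le)

lemma abs_avg_le_of_abs_sub_le {v k : E n → ℝ} (hvc : Continuous v) (hk : IsKernel k)
    (hk0 : ∫ z, k z = 0) {A M c : ℝ} (hA : KernelBound A k) (hM : 0 ≤ M)
    {x : E n} {τ : ℝ} (hv : ∀ z, ‖z‖ ≤ 1 → |v (x + τ • z) - c| ≤ M) :
    |avg v k x τ| ≤ M * A := by
  have h : avg v k x τ = avg (fun y => v y - c) k x τ := by
    simp only [avg, sub_mul]
    rw [integral_sub (hk.integrable_mul (v := fun z => v (x + τ • z)) (hvc.comp (by fun_prop)))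
      (hk.integrable.const_mul c), integral_const_mul, hk0]
    simp
  rw [h]
  exact abs_avg_le hk hA hM hv

/-- Averages of `v` at two points at distance at most `2τ` differ by the Lipschitz constant of the
kernel times the oscillation of `v` around any constant `c`, over the union of the two balls of
radius `τ`. -/
lemma abs_avg_sub_avg_le {v k : E n → ℝ} (hvc : Continuous v) (hk : IsKernel k) {A M : ℝ} (c : ℝ)
    (hA : KernelBound A k) (hM : 0 ≤ M) {x y : E n} {τ : ℝ} (hτ : 0 < τ) (hxy : ‖x - y‖ ≤ 2 * τ)
    (hv : ∀ w, ‖w - x‖ ≤ τ ∨ ‖w - y‖ ≤ τ → |v w - c| ≤ M) :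
    |avg v k x τ - avg v k y τ|
      ≤ M * (A * (‖x - y‖ / τ)) * volume.real (closedBall (0 : E n) 3) := by
  set a : E n := τ⁻¹ • (x - y) with ha
  have hna : ‖a‖ = ‖x - y‖ / τ := by
    rw [ha, norm_smul, norm_inv, Real.norm_of_nonneg hτ.le]
    field_simp
  have hna2 : ‖a‖ ≤ 2 := by
    rw [hna, div_le_iff₀ hτ]
    exact hxy
  have hτa : τ • a = x - y := by rw [ha, smul_inv_smul₀ hτ.ne']
  have hy : avg v k y τ = ∫ z, v (x + τ • z) * k (z + a) := by
    rw [avg, ← integral_add_right_eq_self _ a]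
    refine integral_congr_ae (ae_of_all _ fun z => ?_)
    simp only [smul_add, hτa]
    congr 2
    abel
  have hi1 : Integrable fun z => v (x + τ • z) * k z :=
    hk.integrable_mul (v := fun z => v (x + τ • z)) (hvc.comp (by fun_prop))
  have hi2 : Integrable fun z => v (x + τ • z) * k (z + a) := by
    have h := (hk.integrable_mul (v := fun z => v (x + τ • (z - a)))
      (hvc.comp (by fun_prop))).comp_add_right a
    simpa using h
  have hi12 : Integrable fun z => v (x + τ • z) * k z - v (x + τ • z) * k (z + a) := hi1.sub hi2
  have hi3 : Integrable fun z => c * (k z - k (z + a)) :=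
    (hk.integrable.sub (hk.integrable.comp_add_right a)).const_mul c
  have hc0 : ∫ z, c * (k z - k (z + a)) = 0 := by
    rw [integral_const_mul, integral_sub hk.integrable (hk.integrable.comp_add_right a),
      integral_add_right_eq_self, sub_self, mul_zero]
  have heq : avg v k x τ - avg v k y τ = ∫ z, (v (x + τ • z) - c) * (k z - k (z + a)) := by
    rw [hy, avg, ← integral_sub hi1 hi2, ← sub_zero (∫ z, _), ← hc0,
      ← integral_sub hi12 hi3]
    refine integral_congr_ae (ae_of_all _ fun z => ?_)
    ring
  have hzero : ∀ z, z ∉ closedBall (0 : E n) 3 →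
      (v (x + τ • z) - c) * (k z - k (z + a)) = 0 := by
    intro z hz
    rw [mem_closedBall_zero_iff, not_le] at hz
    have h1 : k z = 0 := by
      by_contra h
      linarith [hk.norm_le_one h]
    have h2 : k (z + a) = 0 := by
      by_contra h
      have h3 := hk.norm_le_one h
      have h4 := norm_sub_le (z + a) a
      rw [add_sub_cancel_right] at h4
      linarith
    simp [h1, h2]
  rw [heq, ← setIntegral_eq_integral_of_forall_compl_eq_zero hzero, ← Real.norm_eq_abs]
  refine norm_setIntegral_le_of_norm_le_const measure_closedBall_lt_top fun z _ => ?_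
  rw [norm_mul, Real.norm_eq_abs, Real.norm_eq_abs]
  have hl : |k z - k (z + a)| ≤ A * (‖x - y‖ / τ) := by
    simpa [hna] using hA.lipschitz z (z + a)
  have hnn : 0 ≤ A * (‖x - y‖ / τ) := (abs_nonneg _).trans hl
  by_cases h : k z = 0 ∧ k (z + a) = 0
  · simp only [h.1, h.2, sub_self, abs_zero, mul_zero]
    positivity
  · refine mul_le_mul (hv _ ?_) hl (abs_nonneg _) hM
    rw [not_and_or] at h
    refine h.imp (fun h => ?_) fun h => ?_
    · simpa [norm_smul, abs_of_pos hτ] using mul_le_mul_of_nonneg_left (hk.norm_le_one h) hτ.le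
    · have h1 : x + τ • z - y = τ • (z + a) := by rw [smul_add, hτa]; abel
      rw [h1, norm_smul, Real.norm_of_nonneg hτ.le]
      simpa using mul_le_mul_of_nonneg_left (hk.norm_le_one h) hτ.le

/-! ### Integrating in the scale -/

/-- A mean value inequality on `[s, r]` with a boundary function. -/
lemma abs_sub_le_of_abs_deriv_le {S S' B B' : ℝ → ℝ} {s r : ℝ} (hsr : s ≤ r)
    (hS : ∀ τ ∈ Icc s r, HasDerivAt S (S' τ) τ) (hB : ∀ τ ∈ Icc s r, HasDerivAt B (B' τ) τ)
    (hle : ∀ τ ∈ Icc s r, |S' τ| ≤ B' τ) : |S r - S s| ≤ B r - B s := by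
  refine image_norm_le_of_norm_deriv_right_le_deriv_boundary' (f := fun τ => S τ - S s)
    (f' := S') (B := fun τ => B τ - B s) (B' := B') (a := s) (b := r)
    (fun τ hτ => ((hS τ hτ).sub_const _).continuousAt.continuousWithinAt)
    (fun τ hτ => ((hS τ (Ico_subset_Icc_self hτ)).sub_const _).hasDerivWithinAt) (by simp)
    (fun τ hτ => ((hB τ hτ).sub_const _).continuousAt.continuousWithinAt)
    (fun τ hτ => ((hB τ (Ico_subset_Icc_self hτ)).sub_const _).hasDerivWithinAt)
    (fun τ hτ => hle τ (Ico_subset_Icc_self hτ)) (right_mem_Icc.2 hsr)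

/-- The version of `abs_sub_le_of_abs_deriv_le` on `(0, r]`, where `S` only has a limit at `0`
and the derivatives may blow up there. -/
lemma abs_sub_le_of_abs_deriv_le_of_tendsto {S S' B B' : ℝ → ℝ} {r ℓ : ℝ} (hr : 0 < r)
    (hS : ∀ τ ∈ Ioc 0 r, HasDerivAt S (S' τ) τ) (hB : ∀ τ ∈ Ioc 0 r, HasDerivAt B (B' τ) τ)
    (hB0 : ∀ τ ∈ Ioc 0 r, 0 ≤ B τ) (hle : ∀ τ ∈ Ioc 0 r, |S' τ| ≤ B' τ)
    (hlim : Tendsto S (𝓝[>] 0) (𝓝 ℓ)) : |S r - ℓ| ≤ B r := by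
  refine le_of_tendsto (tendsto_const_nhds.sub hlim).abs ?_
  filter_upwards [Ioc_mem_nhdsGT hr] with s hs
  have hsub : ∀ τ ∈ Icc s r, τ ∈ Ioc 0 r := fun τ hτ => ⟨hs.1.trans_le hτ.1, hτ.2⟩
  have h := abs_sub_le_of_abs_deriv_le hs.2 (fun τ hτ => hS τ (hsub τ hτ))
    (fun τ hτ => hB τ (hsub τ hτ)) (fun τ hτ => hle τ (hsub τ hτ))
  linarith [hB0 s hs]

lemma hasDerivAt_div_rpow {D a τ : ℝ} (hD : 0 < D) (hτ : 0 < τ) :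
    HasDerivAt (fun τ => (τ / D) ^ a) (a * ((τ / D) ^ a / τ)) τ := by
  have h := ((hasDerivAt_id τ).div_const D).rpow_const (p := a) (Or.inl (div_pos hτ hD).ne')
  refine h.congr_deriv ?_
  rw [id, Real.rpow_sub_one (by positivity)]
  field_simp

lemma tendsto_avg {v k : E n → ℝ} (hv : Continuous v) (hc : HasCompactSupport v)
    (hk : IsKernel k) (hk1 : ∫ z, k z = 1) (x : E n) :
    Tendsto (avg v k x) (𝓝[>] 0) (𝓝 (v x)) := by
  have h := ((continuous_avg hv hc hk x).tendsto 0).mono_left (nhdsWithin_le_nhds (s := Ioi 0))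
  have h0 : avg v k x 0 = v x := by simp [avg, integral_const_mul, hk1]
  rwa [h0] at h

lemma tendsto_avg_dirDeriv {u ρ : E n → ℝ} (hu : ContDiff ℝ 2 u) (hc : HasCompactSupport u)
    (hρ : IsKernel ρ) (hρ1 : ∫ z, ρ z = 1) (i : Fin n) (x : E n) :
    Tendsto (fun τ => (τ ^ 1)⁻¹ * avg u (dirDeriv i ρ) x τ) (𝓝[>] 0) (𝓝 (-dirDeriv i u x)) := by
  have hu1 : ContDiff ℝ 1 u := hu.of_le (by norm_num)
  have hd : Continuous (dirDeriv i u) :=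
    (contDiff_dirDeriv (m := 0) (by simpa using hu1) i).continuous
  refine (tendsto_avg hd (hasCompactSupport_dirDeriv hc i) hρ hρ1 x).neg.congr' ?_
  filter_upwards [self_mem_nhdsWithin] with τ hτ
  have : τ ≠ 0 := ne_of_gt hτ
  rw [avg_dirDeriv hu1 hρ]
  field_simp

lemma tendsto_avg_dirDeriv_dirDeriv {u ρ : E n → ℝ} (hu : ContDiff ℝ 2 u)
    (hc : HasCompactSupport u) (hρ : IsKernel ρ) (hρ1 : ∫ z, ρ z = 1) (i j : Fin n) (x : E n) :
    Tendsto (fun τ => (τ ^ 2)⁻¹ * avg u (dirDeriv i (dirDeriv j ρ)) x τ) (𝓝[>] 0)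
      (𝓝 (dirDeriv j (dirDeriv i u) x)) := by
  have hu1 : ContDiff ℝ 1 (dirDeriv i u) :=
    contDiff_dirDeriv (by simpa [one_add_one_eq_two] using hu) i
  have hd : Continuous (dirDeriv j (dirDeriv i u)) :=
    (contDiff_dirDeriv (m := 0) (by simpa using hu1) j).continuous
  have hcc := hasCompactSupport_dirDeriv (hasCompactSupport_dirDeriv hc i) j
  refine (tendsto_avg hd hcc hρ hρ1 x).congr' ?_
  filter_upwards [self_mem_nhdsWithin] with τ hτ
  have : τ ≠ 0 := ne_of_gt hτ
  rw [avg_dirDeriv (hu.of_le (by norm_num)) (hρ.dirDeriv j), avg_dirDeriv hu1 hρ]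
  field_simp

lemma integral_dirDeriv {k : E n → ℝ} (hk : IsKernel k) (i : Fin n) :
    ∫ z, dirDeriv i k z = 0 := by
  have h := avg_dirDeriv (v := fun _ => 1) contDiff_const hk i 0 0
  simpa [avg] using h

/-! ### The interior estimate for compactly supported functions -/

/-- A mollifier `ρ` and its scaling partner `G`, with a common bound `A` for the kernels that
are used: the first and second partial derivatives of `ρ` and `G`. -/
structure Mollifier (A : ℝ) (ρ G : E n → ℝ) : Prop where
  pair : ScalingPair 0 ρ G
  integral_eq_one : ∫ z, ρ z = 1
  bound_left_one : ∀ i, KernelBound A (dirDeriv i ρ)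
  bound_right_one : ∀ i, KernelBound A (dirDeriv i G)
  bound_left_two : ∀ i j, KernelBound A (dirDeriv i (dirDeriv j ρ))
  bound_right_two : ∀ i j, KernelBound A (dirDeriv i (dirDeriv j G))

lemma exists_mollifier (hn : 1 ≤ n) : ∃ (A : ℝ) (ρ G : E n → ℝ), 0 ≤ A ∧ Mollifier A ρ G := by
  obtain ⟨ρ, G, h, h1⟩ := exists_scalingPair hn
  obtain ⟨A₁, h₁⟩ := exists_kernelBound_forall (fun i => dirDeriv i ρ) fun i => h.left.dirDeriv i
  obtain ⟨A₂, h₂⟩ := exists_kernelBound_forall (fun i => dirDeriv i G) fun i => h.right.dirDeriv i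
  obtain ⟨A₃, h₃⟩ := exists_kernelBound_forall
    (fun p : Fin n × Fin n => dirDeriv p.1 (dirDeriv p.2 ρ))
    fun p => (h.left.dirDeriv p.2).dirDeriv p.1
  obtain ⟨A₄, h₄⟩ := exists_kernelBound_forall
    (fun p : Fin n × Fin n => dirDeriv p.1 (dirDeriv p.2 G))
    fun p => (h.right.dirDeriv p.2).dirDeriv p.1
  have l1 : A₁ ≤ max (max A₁ A₂) (max A₃ A₄) := by simp
  have l2 : A₂ ≤ max (max A₁ A₂) (max A₃ A₄) := by simp
  have l3 : A₃ ≤ max (max A₁ A₂) (max A₃ A₄) := by simp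
  have l4 : A₄ ≤ max (max A₁ A₂) (max A₃ A₄) := by simp
  exact ⟨_, ρ, G, ((h₁ ⟨0, hn⟩).mono l1).nonneg, h, h1, fun i => (h₁ i).mono l1,
    fun i => (h₂ i).mono l2, fun i j => (h₃ (i, j)).mono l3, fun i j => (h₄ (i, j)).mono l4⟩

/-- The data of the interior estimate on `B(x₀, R)`: a compactly supported `C²` function `u` with
`|u| ≤ U` and `|Δu| ≤ N` on `B(x₀, 2R)`, such that `Δu` is Hölder continuous with the variable
exponent `α` there, and an exponent with values in `[a, b] ⊆ (0, 1)`. The constant `K` compares the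
powers with the exponents `α x` and `α y`; it comes from log-Hölder continuity. -/
structure EstimateData (u α : E n → ℝ) (x₀ : E n) (R U N a b K : ℝ) : Prop where
  contDiff : ContDiff ℝ 2 u
  hasCompactSupport : HasCompactSupport u
  R_pos : 0 < R
  U_nonneg : 0 ≤ U
  N_nonneg : 0 ≤ N
  a_pos : 0 < a
  b_lt_one : b < 1
  K_nonneg : 0 ≤ K
  le_exp : ∀ x ∈ ball x₀ (2 * R), a ≤ α x
  exp_le : ∀ x ∈ ball x₀ (2 * R), α x ≤ b
  abs_apply_le : ∀ x ∈ ball x₀ (2 * R), |u x| ≤ U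
  abs_lap_le : ∀ x ∈ ball x₀ (2 * R), |lap u x| ≤ N
  abs_lap_sub_le : ∀ x ∈ ball x₀ (2 * R), ∀ y ∈ ball x₀ (2 * R),
    |lap u x - lap u y| ≤ N * (‖x - y‖ / (4 * R)) ^ α x
  rpow_le : ∀ x ∈ ball x₀ (2 * R), ∀ y ∈ ball x₀ (2 * R), x ≠ y →
    (‖x - y‖ / (4 * R)) ^ α y ≤ K * (‖x - y‖ / (4 * R)) ^ α x

lemma continuous_lap {u : E n → ℝ} (hu : ContDiff ℝ 2 u) : Continuous (lap u) := by
  refine continuous_finsetSum _ fun i _ => ?_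
  have := contDiff_dirDeriv (m := 1) (by simpa [one_add_one_eq_two] using hu) i
  exact (contDiff_dirDeriv (m := 0) (by simpa using this) i).continuous

lemma mem_ball_two_mul {x₀ x w : E n} {R : ℝ} (hx : x ∈ ball x₀ R) (hw : ‖w - x‖ ≤ R) :
    w ∈ ball x₀ (2 * R) := by
  rw [mem_ball] at hx ⊢
  rw [← dist_eq_norm] at hw
  linarith [dist_triangle w x x₀]

namespace EstimateData

variable {u α ρ G : E n → ℝ} {x₀ : E n} {R U N a b K A : ℝ}

lemma norm_smul_le {z : E n} (hz : ‖z‖ ≤ 1) {x : E n} {τ : ℝ} (hτ : 0 ≤ τ) :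
    ‖x + τ • z - x‖ ≤ τ := by
  rw [add_sub_cancel_left, norm_smul, Real.norm_of_nonneg hτ]
  exact mul_le_of_le_one_right hτ hz

lemma add_smul_mem {x z : E n} (hx : x ∈ ball x₀ R)
    (hz : ‖z‖ ≤ 1) {τ : ℝ} (hτ : τ ∈ Ioc 0 R) : x + τ • z ∈ ball x₀ (2 * R) :=
  mem_ball_two_mul hx ((norm_smul_le hz hτ.1.le).trans hτ.2)

lemma abs_avg_le (d : EstimateData u α x₀ R U N a b K) {k : E n → ℝ} (hk : IsKernel k)
    (hA : KernelBound A k) {x : E n} (hx : x ∈ ball x₀ R) : |avg u k x R| ≤ U * A :=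
  VariableHolder.abs_avg_le hk hA d.U_nonneg fun _ hz =>
    d.abs_apply_le _ (add_smul_mem hx hz ⟨d.R_pos, le_rfl⟩)

/-- The gradient bound. -/
lemma abs_dirDeriv_le (d : EstimateData u α x₀ R U N a b K) (hm : Mollifier A ρ G) (i : Fin n)
    {x : E n} (hx : x ∈ ball x₀ R) : |dirDeriv i u x| ≤ A * (U / R + N * R) := by
  have hR := d.R_pos
  have h := abs_sub_le_of_abs_deriv_le_of_tendsto (B := fun τ => N * A * τ)
    (B' := fun _ => N * A) hR
    (fun τ hτ => (hm.pair.dirDeriv i).hasDerivAt_avg d.contDiff d.hasCompactSupport x hτ.1)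
    (fun τ _ => by simpa using (hasDerivAt_id τ).const_mul (N * A))
    (fun τ hτ => mul_nonneg (mul_nonneg d.N_nonneg (hm.bound_left_one i).nonneg) hτ.1.le)
    (fun τ hτ => by
      have h1 : τ ≠ 0 := hτ.1.ne'
      rw [zero_add, pow_one, mul_inv_cancel₀ h1, one_mul]
      exact VariableHolder.abs_avg_le (hm.pair.right.dirDeriv i) (hm.bound_right_one i) d.N_nonneg
        fun z hz => d.abs_lap_le _ (add_smul_mem hx hz hτ))
    (tendsto_avg_dirDeriv d.contDiff d.hasCompactSupport hm.pair.left hm.integral_eq_one i x)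
  have h2 := d.abs_avg_le (hm.pair.left.dirDeriv i) (hm.bound_left_one i) hx
  have h3 : |(R ^ (0 + 1))⁻¹ * avg u (dirDeriv i ρ) x R| ≤ U * A / R := by
    rw [zero_add, pow_one, abs_mul, abs_of_pos (inv_pos.2 hR), inv_mul_eq_div]
    gcongr
  have h4 : A * (U / R + N * R) = U * A / R + N * A * R := by ring
  rw [h4]
  rw [abs_le] at h h3 ⊢
  simp only [zero_add] at h h3
  constructor <;> linarith [h.1, h.2, h3.1, h3.2]

/-- The average of `u` against a second derivative of the mollifier, at scale `r`, differs from the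
second derivative of `u` by `O(r^α(x))`. -/
lemma abs_avg_sub_dirDeriv_le (d : EstimateData u α x₀ R U N a b K) (hm : Mollifier A ρ G)
    (i j : Fin n) {x : E n} (hx : x ∈ ball x₀ R) {r : ℝ} (hr : r ∈ Ioc 0 R) :
    |(r ^ 2)⁻¹ * avg u (dirDeriv i (dirDeriv j ρ)) x r - dirDeriv j (dirDeriv i u) x|
      ≤ N * A / a * (r / (4 * R)) ^ α x := by
  have hR := d.R_pos
  have hA := (hm.bound_left_one i).nonneg
  have hN := d.N_nonneg
  have hx2 : x ∈ ball x₀ (2 * R) := ball_subset_ball (by linarith) hx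
  have hax := d.le_exp x hx2
  have ha := d.a_pos
  have hα : 0 < α x := ha.trans_le hax
  have h := abs_sub_le_of_abs_deriv_le_of_tendsto
    (B := fun τ => N * A / a * (τ / (4 * R)) ^ α x)
    (B' := fun τ => N * A / a * (α x * ((τ / (4 * R)) ^ α x / τ))) hr.1
    (fun τ hτ => ((hm.pair.dirDeriv j).dirDeriv i).hasDerivAt_avg d.contDiff d.hasCompactSupport
      x hτ.1)
    (fun τ hτ => (hasDerivAt_div_rpow (by positivity) hτ.1).const_mul _)
    (fun τ hτ => by
      have := hτ.1
      positivity)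
    (fun τ hτ => by
      have hτ0 := hτ.1
      have h1 : |avg (lap u) (dirDeriv i (dirDeriv j G)) x τ| ≤ N * (τ / (4 * R)) ^ α x * A := by
        refine abs_avg_le_of_abs_sub_le (continuous_lap d.contDiff)
          ((hm.pair.right.dirDeriv j).dirDeriv i) (integral_dirDeriv (hm.pair.right.dirDeriv j) i)
          (c := lap u x) (hm.bound_right_two i j) (by positivity) fun z hz => ?_
        rw [abs_sub_comm]
        refine (d.abs_lap_sub_le x hx2 _
          (add_smul_mem hx hz ⟨hτ0, hτ.2.trans hr.2⟩)).trans ?_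
        rw [norm_sub_rev]
        gcongr
        exact norm_smul_le hz hτ0.le
      have h2 : τ * (τ ^ (0 + 1 + 1))⁻¹ = τ⁻¹ := by field_simp
      rw [h2, abs_mul, abs_of_pos (inv_pos.2 hτ0)]
      calc τ⁻¹ * |avg (lap u) (dirDeriv i (dirDeriv j G)) x τ|
          ≤ τ⁻¹ * (N * (τ / (4 * R)) ^ α x * A) := by gcongr
        _ = N * A / a * (a * ((τ / (4 * R)) ^ α x / τ)) := by field_simp
        _ ≤ N * A / a * (α x * ((τ / (4 * R)) ^ α x / τ)) := by gcongr)
    (tendsto_avg_dirDeriv_dirDeriv d.contDiff d.hasCompactSupport hm.pair.left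
      hm.integral_eq_one i j x)
  exact h

/-- The bound for the second derivatives. -/
lemma abs_dirDeriv_dirDeriv_le (d : EstimateData u α x₀ R U N a b K) (hm : Mollifier A ρ G)
    (i j : Fin n) {x : E n} (hx : x ∈ ball x₀ R) :
    |dirDeriv j (dirDeriv i u) x| ≤ A * (U / R ^ 2 + N / a) := by
  have hR := d.R_pos
  have hA := (hm.bound_left_one i).nonneg
  have hN := d.N_nonneg
  have ha := d.a_pos
  have hx2 : x ∈ ball x₀ (2 * R) := ball_subset_ball (by linarith) hx
  have h := d.abs_avg_sub_dirDeriv_le hm i j hx ⟨hR, le_rfl⟩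
  have h1 : (R / (4 * R)) ^ α x ≤ 1 := by
    refine Real.rpow_le_one (by positivity) ?_ (ha.le.trans (d.le_exp x hx2))
    rw [div_le_one (by positivity)]
    linarith
  have h2 : N * A / a * (R / (4 * R)) ^ α x ≤ N * A / a :=
    mul_le_of_le_one_right (by positivity) h1
  have h3 : |(R ^ 2)⁻¹ * avg u (dirDeriv i (dirDeriv j ρ)) x R| ≤ U * A / R ^ 2 := by
    rw [abs_mul, abs_of_pos (by positivity), inv_mul_eq_div]
    gcongr
    exact d.abs_avg_le ((hm.pair.left.dirDeriv j).dirDeriv i) (hm.bound_left_two i j) hx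
  have h4 : A * (U / R ^ 2 + N / a) = U * A / R ^ 2 + N * A / a := by ring
  rw [h4]
  rw [abs_le] at h h3 ⊢
  constructor <;> linarith [h.1, h.2, h3.1, h3.2]

/-- The averages at `x` and `y` at scale `|x - y| / 2` differ by `O(|x - y|^α(x))`: the scales
between `|x - y| / 2` and `R` contribute a geometric sum, because `α x` stays below `1`. -/
lemma abs_avg_sub_avg_le (d : EstimateData u α x₀ R U N a b K) (hm : Mollifier A ρ G)
    (i j : Fin n) {x y : E n} (hx : x ∈ ball x₀ R) (hy : y ∈ ball x₀ R) (hxy : x ≠ y) :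
    |((‖x - y‖ / 2) ^ 2)⁻¹ * avg u (dirDeriv i (dirDeriv j ρ)) x (‖x - y‖ / 2)
        - ((‖x - y‖ / 2) ^ 2)⁻¹ * avg u (dirDeriv i (dirDeriv j ρ)) y (‖x - y‖ / 2)|
      ≤ (4 * U / R ^ 2 + 6 * N / (1 - b)) * A * volume.real (closedBall (0 : E n) 3)
        * (‖x - y‖ / (4 * R)) ^ α x := by
  set V := volume.real (closedBall (0 : E n) 3) with hV
  have hV0 : 0 ≤ V := measureReal_nonneg
  set t := ‖x - y‖ with ht
  have ht0 : 0 < t := norm_pos_iff.2 (sub_ne_zero.2 hxy)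
  have hR := d.R_pos
  have hA := (hm.bound_left_one i).nonneg
  have hN := d.N_nonneg
  have hU := d.U_nonneg
  have htR : t < 2 * R := by
    rw [mem_ball] at hx hy
    rw [ht, ← dist_eq_norm]
    linarith [dist_triangle_right x y x₀]
  have hx2 : x ∈ ball x₀ (2 * R) := ball_subset_ball (by linarith) hx
  have hα : 0 < α x := d.a_pos.trans_le (d.le_exp x hx2)
  have hαb : α x ≤ b := d.exp_le x hx2
  have hb := d.b_lt_one
  have hb' : 0 < 1 - b := by linarith
  have hα1 : 0 < 1 - α x := by linarith
  set p := ((3 : ℝ) / (4 * R)) ^ α x with hp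
  -- The boundary function is an antiderivative of `N A V t (3τ/4R)^α(x) τ^{-2}`.
  have hB (τ : ℝ) (hτ : 0 < τ) : HasDerivAt
      (fun τ => -(N * A * V * t / (1 - α x)) * ((3 * τ / (4 * R)) ^ α x / τ))
      (N * A * V * t * ((3 * τ / (4 * R)) ^ α x / τ ^ 2)) τ := by
    have h1 : HasDerivAt (fun τ : ℝ => (3 * τ / (4 * R)) ^ α x)
        (α x * ((3 * τ / (4 * R)) ^ α x / τ)) τ := by
      have := hasDerivAt_div_rpow (D := 4 * R / 3) (a := α x) (by positivity) hτ
      have he : ∀ σ : ℝ, σ / (4 * R / 3) = 3 * σ / (4 * R) := fun σ => by field_simp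
      simpa only [he] using this
    refine ((h1.div (hasDerivAt_id τ) hτ.ne').const_mul _).congr_deriv ?_
    simp only [id]
    field_simp
    ring
  have hmid := abs_sub_le_of_abs_deriv_le (s := t / 2) (r := R) (by linarith)
    (fun τ hτ => by
      have hτ0 : 0 < τ := by linarith [hτ.1]
      exact (((hm.pair.dirDeriv j).dirDeriv i).hasDerivAt_avg d.contDiff d.hasCompactSupport
        x hτ0).sub (((hm.pair.dirDeriv j).dirDeriv i).hasDerivAt_avg d.contDiff
        d.hasCompactSupport y hτ0))
    (fun τ hτ => hB τ (by linarith [hτ.1]))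
    (fun τ hτ => by
      have hτ0 : 0 < τ := by linarith [hτ.1]
      have h1 := VariableHolder.abs_avg_sub_avg_le (x := x) (y := y) (τ := τ)
        (M := N * (3 * τ / (4 * R)) ^ α x)
        (continuous_lap d.contDiff) ((hm.pair.right.dirDeriv j).dirDeriv i) (lap u x)
        (hm.bound_right_two i j) (by positivity) hτ0 (by linarith [hτ.1]) (by
          intro w hw
          have hw2 : w ∈ ball x₀ (2 * R) :=
            hw.elim (fun h => mem_ball_two_mul hx (h.trans hτ.2))
              fun h => mem_ball_two_mul hy (h.trans hτ.2)
          have hw3 : ‖x - w‖ ≤ 3 * τ := by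
            rcases hw with h | h
            · rw [norm_sub_rev]
              linarith
            · have h1 : x - w = (x - y) - (w - y) := by abel
              rw [h1]
              have := norm_sub_le (x - y) (w - y)
              linarith [hτ.1]
          rw [abs_sub_comm]
          refine (d.abs_lap_sub_le x hx2 w hw2).trans ?_
          gcongr)
      have h2 : τ * (τ ^ (0 + 1 + 1))⁻¹ = τ⁻¹ := by field_simp
      rw [h2, ← mul_sub, abs_mul, abs_of_pos (inv_pos.2 hτ0)]
      calc _ ≤ τ⁻¹ * (N * (3 * τ / (4 * R)) ^ α x * (A * (t / τ)) * V) := by gcongr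
        _ = _ := by field_simp)
  -- At scale `R` only the sup bound of `u` is used.
  have htop : |(R ^ 2)⁻¹ * avg u (dirDeriv i (dirDeriv j ρ)) x R
      - (R ^ 2)⁻¹ * avg u (dirDeriv i (dirDeriv j ρ)) y R|
      ≤ (4 * U / R ^ 2) * A * V * (t / (4 * R)) ^ α x := by
    have h1 := VariableHolder.abs_avg_sub_avg_le (x := x) (y := y) (τ := R) (M := U)
      d.contDiff.continuous ((hm.pair.left.dirDeriv j).dirDeriv i) 0
      (hm.bound_left_two i j) hU hR (by linarith) (by
        intro w hw
        rw [sub_zero]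
        exact d.abs_apply_le w (hw.elim (mem_ball_two_mul hx) (mem_ball_two_mul hy)))
    have h2 : t / (4 * R) ≤ (t / (4 * R)) ^ α x := by
      refine Real.self_le_rpow_of_le_one (by positivity) ?_ (by linarith)
      rw [div_le_one (by positivity)]
      linarith
    rw [← mul_sub, abs_mul, abs_of_pos (by positivity)]
    calc _ ≤ (R ^ 2)⁻¹ * (U * (A * (t / R)) * V) := by gcongr
      _ = (4 * U / R ^ 2) * A * V * (t / (4 * R)) := by field_simp
      _ ≤ _ := by gcongr
  have hsmall : -(N * A * V * t / (1 - α x)) * ((3 * R / (4 * R)) ^ α x / R)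
      - -(N * A * V * t / (1 - α x)) * ((3 * (t / 2) / (4 * R)) ^ α x / (t / 2))
      ≤ 6 * N / (1 - b) * A * V * (t / (4 * R)) ^ α x := by
    have h1 : 0 ≤ (N * A * V * t / (1 - α x)) * ((3 * R / (4 * R)) ^ α x / R) := by positivity
    have h2 : (3 * (t / 2) / (4 * R)) ^ α x ≤ 3 * (t / (4 * R)) ^ α x := by
      have h3 : 3 * (t / 2) / (4 * R) = (3 / 2) * (t / (4 * R)) := by ring
      rw [h3, Real.mul_rpow (by norm_num) (by positivity)]
      gcongr
      calc ((3 : ℝ) / 2) ^ α x ≤ (3 / 2) ^ (1 : ℝ) :=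
            Real.rpow_le_rpow_of_exponent_le (by norm_num) (by linarith)
        _ ≤ 3 := by norm_num
    have h3 : (N * A * V * t / (1 - α x)) * ((3 * (t / 2) / (4 * R)) ^ α x / (t / 2))
        ≤ (N * A * V * t / (1 - b)) * (3 * (t / (4 * R)) ^ α x / (t / 2)) := by
      gcongr
    have h4 : (N * A * V * t / (1 - b)) * (3 * (t / (4 * R)) ^ α x / (t / 2))
        = 6 * N / (1 - b) * A * V * (t / (4 * R)) ^ α x := by
      field_simp
      ring
    linarith
  have hadd : (4 * U / R ^ 2 + 6 * N / (1 - b)) * A * V * (t / (4 * R)) ^ α x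
      = (4 * U / R ^ 2) * A * V * (t / (4 * R)) ^ α x
        + 6 * N / (1 - b) * A * V * (t / (4 * R)) ^ α x := by ring
  rw [hadd]
  have hmid' := hmid.trans hsmall
  simp only [Pi.sub_apply, zero_add, one_add_one_eq_two] at hmid'
  rw [abs_le] at hmid' htop ⊢
  constructor <;> linarith [hmid'.1, hmid'.2, htop.1, htop.2]

/-- The Hölder bound for the second derivatives. -/
lemma abs_dirDeriv_dirDeriv_sub_le (d : EstimateData u α x₀ R U N a b K) (hm : Mollifier A ρ G)
    (i j : Fin n) {x y : E n} (hx : x ∈ ball x₀ R) (hy : y ∈ ball x₀ R) (hxy : x ≠ y) :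
    |dirDeriv j (dirDeriv i u) x - dirDeriv j (dirDeriv i u) y|
      ≤ ((4 * U / R ^ 2 + 6 * N / (1 - b)) * A * volume.real (closedBall (0 : E n) 3)
        + N * A / a * (1 + K)) * (‖x - y‖ / (4 * R)) ^ α x := by
  have hR := d.R_pos
  have hA := (hm.bound_left_one i).nonneg
  have hN := d.N_nonneg
  have ha := d.a_pos
  have ht0 : 0 < ‖x - y‖ := norm_pos_iff.2 (sub_ne_zero.2 hxy)
  have htR : ‖x - y‖ < 2 * R := by
    rw [mem_ball] at hx hy
    rw [← dist_eq_norm]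
    linarith [dist_triangle_right x y x₀]
  have hball : ball x₀ R ⊆ ball x₀ (2 * R) := ball_subset_ball (by linarith)
  have hr : ‖x - y‖ / 2 ∈ Ioc 0 R := ⟨by positivity, by linarith⟩
  have h1 := d.abs_avg_sub_avg_le hm i j hx hy hxy
  have hhalf (z : E n) (hz : z ∈ ball x₀ R) : (‖x - y‖ / 2 / (4 * R)) ^ α z
      ≤ (‖x - y‖ / (4 * R)) ^ α z :=
    Real.rpow_le_rpow (by positivity) (by gcongr; linarith)
      (ha.le.trans (d.le_exp z (hball hz)))
  have h2 : _ ≤ N * A / a * (‖x - y‖ / (4 * R)) ^ α x :=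
    (d.abs_avg_sub_dirDeriv_le hm i j hx hr).trans
      (mul_le_mul_of_nonneg_left (hhalf x hx) (by positivity))
  have h3 : _ ≤ N * A / a * (K * (‖x - y‖ / (4 * R)) ^ α x) :=
    (d.abs_avg_sub_dirDeriv_le hm i j hy hr).trans
      (mul_le_mul_of_nonneg_left ((hhalf y hy).trans (d.rpow_le x (hball hx) y (hball hy) hxy))
        (by positivity))
  rw [add_mul, mul_assoc (N * A / a), add_mul (1 : ℝ), one_mul, mul_add]
  rw [abs_le] at h1 h2 h3 ⊢
  constructor <;> linarith [h1.1, h1.2, h2.1, h2.2, h3.1, h3.2]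

end EstimateData

/-! ### Variable exponents and the norms -/

lemma IsLogExponent.isLogHolderConst_cLog {α : E n → ℝ} {Ω : Set (E n)} (h : IsLogExponent α Ω) :
    IsLogHolderConst α Ω (cLog α Ω) := by
  obtain ⟨M, hM0, hM⟩ := h.logHolder
  exact fun x hx y hy => le_csInf ⟨M, hM0.le, hM⟩ fun M' hM' => hM'.2 x hx y hy

lemma IsLogExponent.expInf_le {α : E n → ℝ} {Ω : Set (E n)} (h : IsLogExponent α Ω) {x : E n}
    (hx : x ∈ Ω) : expInf α Ω ≤ α x :=
  csInf_le ⟨0, forall_mem_image.2 fun y hy => (h.mem_Ioc y hy).1.le⟩ (mem_image_of_mem α hx)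

lemma IsLogExponent.le_expSup {α : E n → ℝ} {Ω : Set (E n)} (h : IsLogExponent α Ω) {x : E n}
    (hx : x ∈ Ω) : α x ≤ expSup α Ω :=
  le_csSup ⟨1, forall_mem_image.2 fun y hy => (h.mem_Ioc y hy).2⟩ (mem_image_of_mem α hx)

/-- Log-Hölder continuity makes the powers `(|x - y| / s)^α(x)` and `(|x - y| / s)^α(y)`
comparable, uniformly in the length `s ∈ [|x - y|, D]`. There is no loss as `s → 0`, because
`|log (|x - y| / s)| = log s - log |x - y|` exceeds `|log |x - y||` by at most `log (1 + D)`. -/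
lemma IsLogExponent.rpow_le {α : E n → ℝ} {Ω : Set (E n)} (h : IsLogExponent α Ω) {x y : E n}
    (hx : x ∈ Ω) (hy : y ∈ Ω) (hxy : x ≠ y) {s D : ℝ} (hs : ‖x - y‖ ≤ s) (hsD : s ≤ D) :
    (‖x - y‖ / s) ^ α y ≤ Real.exp (cLog α Ω) * (1 + D) * (‖x - y‖ / s) ^ α x := by
  have ht : 0 < ‖x - y‖ := norm_pos_iff.2 (sub_ne_zero.2 hxy)
  have hs0 : 0 < s := ht.trans_le hs
  have hD0 : 0 < 1 + D := by linarith
  have hq : 0 < ‖x - y‖ / s := by positivity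
  have hc := h.isLogHolderConst_cLog x hx y hy
  have hdiff : |α x - α y| ≤ 1 := by
    have h1 := h.mem_Ioc x hx
    have h2 := h.mem_Ioc y hy
    rw [abs_le]
    constructor <;> linarith [h1.1, h1.2, h2.1, h2.2]
  have hlog : -Real.log (‖x - y‖ / s) ≤ |Real.log ‖x - y‖| + Real.log (1 + D) := by
    rw [Real.log_div ht.ne' hs0.ne']
    have := Real.log_le_log hs0 (by linarith : s ≤ 1 + D)
    linarith [neg_abs_le (Real.log ‖x - y‖)]
  have hlog0 : 0 ≤ -Real.log (‖x - y‖ / s) :=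
    neg_nonneg.2 (Real.log_nonpos hq.le ((div_le_one hs0).2 hs))
  have hlogD : 0 ≤ Real.log (1 + D) := Real.log_nonneg (by linarith)
  have hexp : Real.log (‖x - y‖ / s) * (α y - α x) ≤ cLog α Ω + Real.log (1 + D) := by
    calc Real.log (‖x - y‖ / s) * (α y - α x)
        = -Real.log (‖x - y‖ / s) * (α x - α y) := by ring
      _ ≤ -Real.log (‖x - y‖ / s) * |α x - α y| := by gcongr; exact le_abs_self _
      _ ≤ (|Real.log ‖x - y‖| + Real.log (1 + D)) * |α x - α y| := by gcongr
      _ = |Real.log ‖x - y‖| * |α x - α y| + Real.log (1 + D) * |α x - α y| := by ring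
      _ ≤ cLog α Ω + Real.log (1 + D) := add_le_add hc (mul_le_of_le_one_right hlogD hdiff)
  calc (‖x - y‖ / s) ^ α y
      = (‖x - y‖ / s) ^ (α y - α x) * (‖x - y‖ / s) ^ α x := by
        rw [← Real.rpow_add hq, sub_add_cancel]
    _ ≤ Real.exp (cLog α Ω) * (1 + D) * (‖x - y‖ / s) ^ α x := by
        gcongr
        calc (‖x - y‖ / s) ^ (α y - α x)
            = Real.exp (Real.log (‖x - y‖ / s) * (α y - α x)) := Real.rpow_def_of_pos hq _
          _ ≤ Real.exp (cLog α Ω + Real.log (1 + D)) := Real.exp_le_exp.2 hexp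
          _ = Real.exp (cLog α Ω) * (1 + D) := by rw [Real.exp_add, Real.exp_log hD0]

lemma pderiv_zero (β : Fin 0 → Fin n) (u : E n → ℝ) (x : E n) : pderiv β u x = u x := by
  simp [pderiv]

lemma pderiv_one (β : Fin 1 → Fin n) (u : E n → ℝ) (x : E n) :
    pderiv β u x = dirDeriv (β 0) u x := by
  simp [pderiv, dirDeriv]

lemma pderiv_two (β : Fin 2 → Fin n) {u : E n → ℝ} (hu : ContDiff ℝ 2 u) (x : E n) :
    pderiv β u x = dirDeriv (β 0) (dirDeriv (β 1) u) x := by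
  rw [pderiv, iteratedFDeriv_two_apply, fderiv_fderiv_single hu]

lemma laplacian_eq_lap {u : E n → ℝ} (hu : ContDiff ℝ 2 u) (x : E n) :
    Laplacian.laplacian u x = lap u x := by
  rw [InnerProductSpace.laplacian_eq_iteratedFDeriv_orthonormalBasis u
    (EuclideanSpace.basisFun (Fin n) ℝ)]
  simp [iteratedFDeriv_two_apply, fderiv_fderiv_single hu, lap]

lemma ofReal_le_supDeriv {k : ℕ} (u : E n → ℝ) {A : Set (E n)} {x : E n} (hx : x ∈ A)
    (β : Fin k → Fin n) : ENNReal.ofReal |pderiv β u x| ≤ supDeriv k u A :=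
  le_iSup₂_of_le x hx (le_iSup_of_le β le_rfl)

lemma ofReal_le_scaledHolderSeminorm {k : ℕ} (α u : E n → ℝ) {A : Set (E n)} {x y : E n}
    (hx : x ∈ A) (hy : y ∈ A) (hxy : x ≠ y) (β : Fin k → Fin n) :
    ENNReal.ofReal (diam A ^ ((k : ℝ) + α x) *
      (|pderiv β u x - pderiv β u y| / ‖x - y‖ ^ α x)) ≤ scaledHolderSeminorm k α u A :=
  le_iSup₂_of_le x hx (le_iSup₂_of_le y hy (le_iSup₂_of_le hxy β le_rfl))

/-- A `C²` function on an open set agrees on a relatively compact ball with a compactly supported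
`C²` function on the whole space. -/
lemma exists_contDiff_eqOn {Ω : Set (E n)} (hΩ : IsOpen Ω) {u : E n → ℝ}
    (hu : ContDiffOn ℝ 2 u Ω) {x₀ : E n} {r : ℝ} (hr : 0 < r) (hb : closedBall x₀ r ⊆ Ω) :
    ∃ v : E n → ℝ, ContDiff ℝ 2 v ∧ HasCompactSupport v ∧ EqOn u v (ball x₀ r) := by
  obtain ⟨δ, hδ, hδΩ⟩ := (isCompact_closedBall x₀ r).exists_cthickening_subset_open hΩ hb
  rw [cthickening_closedBall hδ.le hr.le] at hδΩ
  let χ : ContDiffBump x₀ := ⟨r, δ + r, hr, by linarith⟩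
  have hsupp : tsupport (fun x => χ x * u x) ⊆ closedBall x₀ (δ + r) :=
    (tsupport_mul_subset_left (f := χ)).trans χ.tsupport_eq.subset
  refine ⟨fun x => χ x * u x, ?_, ?_, ?_⟩
  · rw [contDiff_iff_contDiffAt]
    intro x
    by_cases hx : x ∈ closedBall x₀ (δ + r)
    · exact χ.contDiffAt.mul (hu.contDiffAt (hΩ.mem_nhds (hδΩ hx)))
    · exact contDiffAt_const (c := (0 : ℝ)) |>.congr_of_eventuallyEq
        (notMem_tsupport_iff_eventuallyEq.1 fun h => hx (hsupp h))
  · exact (isCompact_closedBall _ _).of_isClosed_subset (isClosed_tsupport _) hsupp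
  · intro x hx
    simp [χ.one_of_mem_closedBall (ball_subset_closedBall hx)]

/-- The constant of the interior estimate. -/
def schauderConst (A V a b K : ℝ) : ℝ :=
  1 + 2 * A + 4 * (A * (1 + 1 / a)) + 4 * ((4 + 6 / (1 - b)) * A * V + A / a * (1 + K))

/-- The pointwise bounds for a compactly supported function, collected in the norm. -/
lemma EstimateData.scaledHolderNorm_le {u α ρ G : E n → ℝ} {x₀ : E n} {R U N a b K A : ℝ}
    (d : EstimateData u α x₀ R U N a b K) (hn : 1 ≤ n) (hA : 0 ≤ A) (hm : Mollifier A ρ G) :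
    scaledHolderNorm 2 α u (ball x₀ R) ≤ ENNReal.ofReal
      (schauderConst A (volume.real (closedBall (0 : E n) 3)) a b K * (U + R ^ 2 * N)) := by
  have : Nonempty (Fin n) := ⟨⟨0, hn⟩⟩
  have hR := d.R_pos
  have hN := d.N_nonneg
  have hU := d.U_nonneg
  have ha := d.a_pos
  have hK := d.K_nonneg
  have hb : 0 < 1 - b := by linarith [d.b_lt_one]
  have hball : ball x₀ R ⊆ ball x₀ (2 * R) := ball_subset_ball (by linarith)
  set V := volume.real (closedBall (0 : E n) 3) with hV
  have hV0 : 0 ≤ V := measureReal_nonneg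
  set B := (4 * U / R ^ 2 + 6 * N / (1 - b)) * A * V + N * A / a * (1 + K) with hB
  have hB0 : 0 ≤ B := by positivity
  have hdiam : diam (ball x₀ R) = 2 * R := diam_ball_eq x₀ hR.le
  have h0 : supDeriv 0 u (ball x₀ R) ≤ ENNReal.ofReal U := by
    refine iSup₂_le fun x hx => iSup_le fun β => ENNReal.ofReal_le_ofReal ?_
    rw [pderiv_zero]
    exact d.abs_apply_le x (hball hx)
  have h1 : supDeriv 1 u (ball x₀ R) ≤ ENNReal.ofReal (A * (U / R + N * R)) := by
    refine iSup₂_le fun x hx => iSup_le fun β => ENNReal.ofReal_le_ofReal ?_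
    rw [pderiv_one]
    exact d.abs_dirDeriv_le hm _ hx
  have h2 : supDeriv 2 u (ball x₀ R) ≤ ENNReal.ofReal (A * (U / R ^ 2 + N / a)) := by
    refine iSup₂_le fun x hx => iSup_le fun β => ENNReal.ofReal_le_ofReal ?_
    rw [pderiv_two β d.contDiff]
    exact d.abs_dirDeriv_dirDeriv_le hm _ _ hx
  have h3 : scaledHolderSeminorm 2 α u (ball x₀ R) ≤ ENNReal.ofReal (4 * R ^ 2 * B) := by
    refine iSup₂_le fun x hx => iSup₂_le fun y hy => iSup₂_le fun hxy β =>
      ENNReal.ofReal_le_ofReal ?_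
    have ht0 : 0 < ‖x - y‖ := norm_pos_iff.2 (sub_ne_zero.2 hxy)
    have h := d.abs_dirDeriv_dirDeriv_sub_le hm (β 1) (β 0) hx hy hxy
    have hα : 0 ≤ α x := ha.le.trans (d.le_exp x (hball hx))
    rw [pderiv_two β d.contDiff, pderiv_two β d.contDiff, hdiam]
    have hp : (2 * R) ^ (((2 : ℕ) : ℝ) + α x) = 4 * R ^ 2 * (2 * R) ^ α x := by
      rw [Real.rpow_add (by positivity), Real.rpow_natCast]
      ring
    have hq : (2 * R) ^ α x * (‖x - y‖ / (4 * R)) ^ α x ≤ ‖x - y‖ ^ α x := by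
      rw [← Real.mul_rpow (by positivity) (by positivity)]
      refine Real.rpow_le_rpow (by positivity) ?_ hα
      have : 2 * R * (‖x - y‖ / (4 * R)) = ‖x - y‖ / 2 := by field_simp; norm_num
      linarith
    rw [hp, mul_div_assoc', div_le_iff₀ (by positivity)]
    calc _ ≤ 4 * R ^ 2 * (2 * R) ^ α x * (B * (‖x - y‖ / (4 * R)) ^ α x) := by gcongr
      _ = 4 * R ^ 2 * B * ((2 * R) ^ α x * (‖x - y‖ / (4 * R)) ^ α x) := by ring
      _ ≤ _ := by gcongr
  have hsum : U + 2 * R * (A * (U / R + N * R)) + (2 * R) ^ 2 * (A * (U / R ^ 2 + N / a))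
      + 4 * R ^ 2 * B ≤ schauderConst A V a b K * (U + R ^ 2 * N) := by
    have e1 : 2 * R * (A * (U / R + N * R)) = 2 * A * (U + R ^ 2 * N) := by field_simp
    have e2 : (2 * R) ^ 2 * (A * (U / R ^ 2 + N / a)) = 4 * A * (U + R ^ 2 * N * (1 / a)) := by
      field_simp
      ring
    have e3 : 4 * R ^ 2 * B = 4 * ((4 * U + 6 / (1 - b) * (R ^ 2 * N)) * A * V
        + A / a * (1 + K) * (R ^ 2 * N)) := by
      rw [hB]
      field_simp
    rw [e1, e2, e3, schauderConst]
    have hRN : 0 ≤ R ^ 2 * N := by positivity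
    have f1 : 0 ≤ 1 / a := by positivity
    have f2 : 0 ≤ 6 / (1 - b) := by positivity
    have f3 : 0 ≤ A / a * (1 + K) := by positivity
    have g1 : 0 ≤ A * (R ^ 2 * N) := by positivity
    have g2 : 0 ≤ A * (1 / a) * U := by positivity
    have g3 : 0 ≤ A * V * (R ^ 2 * N) := by positivity
    have g4 : 0 ≤ 6 / (1 - b) * A * V * U := by positivity
    have g5 : 0 ≤ A / a * (1 + K) * U := by positivity
    linarith
  calc scaledHolderNorm 2 α u (ball x₀ R)
      ≤ ENNReal.ofReal U + ENNReal.ofReal (2 * R * (A * (U / R + N * R)))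
        + ENNReal.ofReal ((2 * R) ^ 2 * (A * (U / R ^ 2 + N / a)))
        + ENNReal.ofReal (4 * R ^ 2 * B) := by
        rw [scaledHolderNorm, scaledCkNorm, hdiam, Finset.sum_range_succ, Finset.sum_range_succ,
          Finset.sum_range_one, pow_zero, pow_one, ENNReal.ofReal_one, one_mul,
          ENNReal.ofReal_mul (by positivity : (0 : ℝ) ≤ 2 * R),
          ENNReal.ofReal_mul (by positivity : (0 : ℝ) ≤ (2 * R) ^ 2)]
        gcongr
    _ = ENNReal.ofReal (U + 2 * R * (A * (U / R + N * R))
        + (2 * R) ^ 2 * (A * (U / R ^ 2 + N / a)) + 4 * R ^ 2 * B) := by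
        rw [← ENNReal.ofReal_add, ← ENNReal.ofReal_add, ← ENNReal.ofReal_add] <;> positivity
    _ ≤ _ := ENNReal.ofReal_le_ofReal hsum

lemma scaledHolderNorm_congr {k : ℕ} {α u v : E n → ℝ} {A : Set (E n)} (hA : IsOpen A)
    (h : EqOn u v A) : scaledHolderNorm k α u A = scaledHolderNorm k α v A := by
  have hp (j : ℕ) (β : Fin j → Fin n) (x : E n) (hx : x ∈ A) : pderiv β u x = pderiv β v x := by
    have he : u =ᶠ[𝓝 x] v := Filter.eventuallyEq_of_mem (hA.mem_nhds hx) h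
    rw [pderiv, pderiv, (he.iteratedFDeriv ℝ j).eq_of_nhds]
  have h1 (j : ℕ) : supDeriv j u A = supDeriv j v A :=
    biSup_congr fun x hx => iSup_congr fun β => by rw [hp j β x hx]
  have h2 : scaledHolderSeminorm k α u A = scaledHolderSeminorm k α v A :=
    biSup_congr fun x hx => biSup_congr fun y hy => iSup_congr fun _ => iSup_congr fun β => by
      rw [hp k β x hx, hp k β y hy]
  simp only [scaledHolderNorm, scaledCkNorm, h1, h2]

/-- The interior estimate with its explicit constant. The right-hand side may be infinite. -/
lemma scaledHolderNorm_two_le {A : ℝ} {ρ G : E n → ℝ} (hn : 1 ≤ n) (hA : 0 ≤ A)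
    (hm : Mollifier A ρ G) {Ω : Set (E n)} (hΩ : IsOpen Ω) (hΩb : Bornology.IsBounded Ω)
    {α f u : E n → ℝ} (hα : IsLogExponent α Ω) (hu : ContDiffOn ℝ 2 u Ω)
    (huf : ∀ x ∈ Ω, Laplacian.laplacian u x = f x) {x₀ : E n} {R : ℝ} (hR : 0 < R)
    (hB : closedBall x₀ (2 * R) ⊆ Ω) :
    scaledHolderNorm 2 α u (ball x₀ R) ≤
      ENNReal.ofReal (schauderConst A (volume.real (closedBall (0 : E n) 3)) (expInf α Ω)
        (expSup α Ω) (Real.exp (cLog α Ω) * (1 + diam Ω))) *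
      (supDeriv 0 u (ball x₀ (2 * R)) +
        ENNReal.ofReal (R ^ 2) * scaledHolderNorm 0 α f (ball x₀ (2 * R))) := by
  have : Nonempty (Fin n) := ⟨⟨0, hn⟩⟩
  have ha := hα.expInf_pos
  have hb : 0 < 1 - expSup α Ω := by linarith [hα.expSup_lt_one]
  have hD0 : 0 ≤ diam Ω := diam_nonneg
  have hV0 : 0 ≤ volume.real (closedBall (0 : E n) 3) := measureReal_nonneg
  set K := Real.exp (cLog α Ω) * (1 + diam Ω) with hK
  have hK0 : 0 ≤ K := by positivity
  set C := schauderConst A (volume.real (closedBall (0 : E n) 3)) (expInf α Ω) (expSup α Ω) K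
    with hC
  have hC0 : 0 < C := by
    rw [hC, schauderConst]
    positivity
  have hC0' : ENNReal.ofReal C ≠ 0 := (ENNReal.ofReal_pos.2 hC0).ne'
  have hR2 : ENNReal.ofReal (R ^ 2) ≠ 0 := (ENNReal.ofReal_pos.2 (by positivity)).ne'
  -- If a term on the right-hand side is infinite there is nothing to prove.
  by_cases hUtop : supDeriv 0 u (ball x₀ (2 * R)) = ⊤
  · simp [hUtop, ENNReal.mul_top hC0']
  by_cases hNtop : scaledHolderNorm 0 α f (ball x₀ (2 * R)) = ⊤
  · simp [hNtop, ENNReal.mul_top hC0', ENNReal.mul_top hR2]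
  set U := (supDeriv 0 u (ball x₀ (2 * R))).toReal with hU
  set N := (scaledHolderNorm 0 α f (ball x₀ (2 * R))).toReal with hN
  have hballΩ : ball x₀ (2 * R) ⊆ Ω := ball_subset_closedBall.trans hB
  have hdiam : diam (ball x₀ (2 * R)) = 4 * R := by
    rw [diam_ball_eq x₀ (by positivity)]
    ring
  have hDR : 4 * R ≤ diam Ω := hdiam ▸ diam_mono hballΩ hΩb
  obtain ⟨v, hv, hvc, huv⟩ := exists_contDiff_eqOn hΩ hu (by positivity) hB
  have hlap (x : E n) (hx : x ∈ ball x₀ (2 * R)) : lap v x = f x := by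
    rw [← laplacian_eq_lap hv, ← huf x (hballΩ hx)]
    exact (InnerProductSpace.laplacian_congr_nhds
      (Filter.eventuallyEq_of_mem (isOpen_ball.mem_nhds hx) huv)).symm.eq_of_nhds
  have hN1 (x : E n) (hx : x ∈ ball x₀ (2 * R)) : |f x| ≤ N := by
    refine (ENNReal.ofReal_le_iff_le_toReal hNtop).1 ?_
    have h := ofReal_le_supDeriv f hx (Fin.elim0 : Fin 0 → Fin n)
    rw [pderiv_zero] at h
    refine h.trans ?_
    simp [scaledHolderNorm, scaledCkNorm]
  have hN2 (x : E n) (hx : x ∈ ball x₀ (2 * R)) (y : E n) (hy : y ∈ ball x₀ (2 * R)) :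
      |f x - f y| ≤ N * (‖x - y‖ / (4 * R)) ^ α x := by
    rcases eq_or_ne x y with rfl | hxy
    · simp only [sub_self, abs_zero]
      positivity
    have ht0 : 0 < ‖x - y‖ := norm_pos_iff.2 (sub_ne_zero.2 hxy)
    have hle : scaledHolderSeminorm 0 α f (ball x₀ (2 * R))
        ≤ scaledHolderNorm 0 α f (ball x₀ (2 * R)) := le_add_self
    have h := (ofReal_le_scaledHolderSeminorm α f hx hy hxy
      (Fin.elim0 : Fin 0 → Fin n)).trans hle
    rw [ENNReal.ofReal_le_iff_le_toReal hNtop, ← hN, pderiv_zero, pderiv_zero, hdiam,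
      Nat.cast_zero, zero_add, mul_div_assoc', div_le_iff₀ (by positivity)] at h
    rw [Real.div_rpow ht0.le (by positivity), mul_div_assoc', le_div_iff₀ (by positivity)]
    linarith
  have d : EstimateData v α x₀ R U N (expInf α Ω) (expSup α Ω) K :=
    { contDiff := hv
      hasCompactSupport := hvc
      R_pos := hR
      U_nonneg := ENNReal.toReal_nonneg
      N_nonneg := ENNReal.toReal_nonneg
      a_pos := ha
      b_lt_one := hα.expSup_lt_one
      K_nonneg := hK0
      le_exp := fun x hx => hα.expInf_le (hballΩ hx)
      exp_le := fun x hx => hα.le_expSup (hballΩ hx)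
      abs_apply_le := fun x hx => by
        rw [← huv hx]
        refine (ENNReal.ofReal_le_iff_le_toReal hUtop).1 ?_
        have h := ofReal_le_supDeriv u hx (Fin.elim0 : Fin 0 → Fin n)
        rwa [pderiv_zero] at h
      abs_lap_le := fun x hx => by
        rw [hlap x hx]
        exact hN1 x hx
      abs_lap_sub_le := fun x hx y hy => by
        rw [hlap x hx, hlap y hy]
        exact hN2 x hx y hy
      rpow_le := fun x hx y hy hxy => by
        refine hα.rpow_le (hballΩ hx) (hballΩ hy) hxy ?_ hDR
        rw [mem_ball] at hx hy
        rw [← dist_eq_norm]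
        linarith [dist_triangle_right x y x₀] }
  rw [scaledHolderNorm_congr isOpen_ball (huv.mono (ball_subset_ball (by linarith)))]
  refine (d.scaledHolderNorm_le hn hA hm).trans_eq ?_
  rw [ENNReal.ofReal_mul hC0.le, ENNReal.ofReal_add d.U_nonneg
    (mul_nonneg (by positivity) d.N_nonneg), ENNReal.ofReal_mul (by positivity),
    ENNReal.ofReal_toReal hUtop, ENNReal.ofReal_toReal hNtop]

end VariableHolder

end

theorem theorem3p2 :
    ∃ C : (diamΩ : ℝ) → (n : ℕ) → (αInf αSup cLogα : ℝ) → ℝ≥0,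
      ∀ (n : ℕ), 1 ≤ n →
      ∀ (Ω : Set (EuclideanSpace ℝ (Fin n))),
        IsOpen Ω → IsConnected Ω → Bornology.IsBounded Ω →
      ∀ (α : EuclideanSpace ℝ (Fin n) → ℝ), VariableHolder.IsLogExponent α Ω →
      ∀ (f : EuclideanSpace ℝ (Fin n) → ℝ), VariableHolder.MemHolder α f Ω →
      ∀ (u : EuclideanSpace ℝ (Fin n) → ℝ), ContDiffOn ℝ 2 u Ω →
        (∀ x ∈ Ω, Laplacian.laplacian u x = f x) →
      ∀ (x₀ : EuclideanSpace ℝ (Fin n)) (R : ℝ), 0 < R →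
        VariableHolder.CompactlyContained (Metric.ball x₀ (2 * R)) Ω →
        VariableHolder.scaledHolderNorm 2 α u (Metric.ball x₀ R) ≤
          (C (Metric.diam Ω) n (VariableHolder.expInf α Ω) (VariableHolder.expSup α Ω) (VariableHolder.cLog α Ω) : ℝ≥0∞) *
            (VariableHolder.supDeriv 0 u (Metric.ball x₀ (2 * R)) +
              ENNReal.ofReal (R ^ 2) *
                VariableHolder.scaledHolderNorm 0 α f (Metric.ball x₀ (2 * R))) := by
  have hA : ∀ n : ℕ, ∃ A : ℝ, 1 ≤ n → ∃ ρ G : VariableHolder.E n → ℝ,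
      0 ≤ A ∧ VariableHolder.Mollifier A ρ G := fun n => by
    by_cases hn : 1 ≤ n
    · obtain ⟨A, h⟩ := VariableHolder.exists_mollifier hn
      exact ⟨A, fun _ => h⟩
    · exact ⟨0, fun h => absurd h hn⟩
  choose A hA using hA
  refine ⟨fun D n a b c => (VariableHolder.schauderConst (A n)
    (MeasureTheory.volume.real (Metric.closedBall (0 : VariableHolder.E n) 3)) a b
    (Real.exp c * (1 + D))).toNNReal, ?_⟩
  intro n hn Ω hΩ _ hΩb α hα f _ u hu huf x₀ R hR hB
  obtain ⟨ρ, G, hA0, hm⟩ := hA n hn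
  refine VariableHolder.scaledHolderNorm_two_le hn hA0 hm hΩ hΩb hα hu huf hR ?_
  rw [← closure_ball x₀ (by positivity)]
  exact hB.2
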